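/- **Setting.** Let $d,m\ge 1$ and let $T_1,\dots,T_m$ be invertible real $d\times d$ matrices with $\|T_i\|<1$ for all $i$, where $\|\cdot\|$ is the operator norm for the Euclidean norm on $\mathbb R^d$. Let $\Sigma=\{1,\dots,m\}^{\mathbb N}$ with the product topology. For $\mathbf a=(a_1,\dots,a_m)\in\mathbb R^{md}$ put $f_i^{\mathbf a}(v)=T_iv+a_i$ and let $$\pi^{\mathbf a}(x)=\lim_{n\to\infty} f^{\mathbf a}_{x_1}\circ\cdots\circ f^{\mathbf a}_{x_n}(0)\qquad (x=(x_i)_{i\ge1}\in\Sigma)$$ be the coding map. For a Borel probability measure $\mu$ on $\Sigma$ let $\pi^{\mathbf a}_*\mu=\mu\circ(\pi^{\mathbf a})^{-1}$. For a Borel probability measure $\eta$ on $\mathbb R^d$, with $B(z,r)$ the closed ball, put $$\underline{\dim}_{\rm loc}(\eta,z)=\liminf_{r\to0}\frac{\log\eta(B(z,r))}{\log r},\qquad \overline{\dim}_{\rm loc}(\eta,z)=\limsup_{r\to0}\frac{\log\eta(B(z,r))}{\log r}.$$ The lower and upper Hausdorff dimensions $\underline{\dim}_{\rm H}\eta$,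 $\overline{\dim}_{\rm H}\eta$ are the $\eta$-essential infimum and supremum of $z\mapsto\underline{\dim}_{\rm loc}(\eta,z)$; the lower and upper packing dimensions $\underline{\dim}_{\rm P}\eta$, $\overline{\dim}_{\rm P}\eta$ are the $\eta$-essential infimum and supremum of $z\mapsto\overline{\dim}_{\rm loc}(\eta,z)$. For an invertible $d\times d$ matrix $T$ with singular values $\alpha_1(T)\ge\dots\ge\alpha_d(T)$ put $$\phi^s(T)=\begin{cases}\alpha_1(T)\cdots\alpha_k(T)\,\alpha_{k+1}(T)^{s-k}, & 0\le s<d,\ k=\lfloor s\rfloor,\\ |\det T|^{s/d}, & d\le s<\infty,\end{cases}\qquad \phi^\infty(T)=0.$$ For $x\in\Sigma$ and $n\ge0$ let $T_{x|n}=T_{x_1}\cdots T_{x_n}$ (the identity if $n=0$) and $[x_1\cdots x_n]=\{y\in\Sigma: y_i=x_i \text{ for } 1\le i\le n\}$. For $n\ge1$ let $S_n(\mu,x)$ be the unique $t\in[0,\infty]$ with $\phi^t(T_{x|n})=\mu([x_1\cdots x_n])$, and let $S(\mu,x)=\liminf_{n\to\infty}S_n(\mu,x)$. Let $\underline S(\mu)$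 and $\overline S(\mu)$ be the $\mu$-essential infimum and supremum of $S(\mu,\cdot)$. For $x\ne y$ in $\Sigma$ let $x\wedge y$ be their longest common initial segment, $T_{x\wedge y}$ the corresponding product, and for $r>0$ $$Z_{x\wedge y}(r)=\prod_{k=1}^d\frac{\min\{r,\alpha_k(T_{x\wedge y})\}}{\alpha_k(T_{x\wedge y})};$$ put $Z_{x\wedge x}(r)=1$. Let $$G_\mu(x,r)=\int_\Sigma Z_{x\wedge y}(r)\,d\mu(y),\qquad D(\mu,x)=\limsup_{r\to0}\frac{\log G_\mu(x,r)}{\log r},$$ and let $\underline D(\mu)$ and $\overline D(\mu)$ be the $\mu$-essential infimum and supremum of $D(\mu,\cdot)$. **Theorem.** Let $\mu$ be a Borel probability measure on $\Sigma$. (i) For every $\mathbf a\in\mathbb R^{md}$, $$\underline{\dim}_{\rm loc}(\pi^{\mathbf a}_*\mu,\pi^{\mathbf a}x)\le\min\{S(\mu,x),d\}\quad\text{and}\quad \overline{\dim}_{\rm loc}(\pi^{\mathbf a}_*\mu,\pi^{\mathbf a}x)\le D(\mu,x)\quad\text{for }\mu\text{-a.e. }x\in\Sigma,$$ and consequently $\underline{\dim}_{\rm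 H}\pi^{\mathbf a}_*\mu\le\min\{\underline S(\mu),d\}$, $\overline{\dim}_{\rm H}\pi^{\mathbf a}_*\mu\le\min\{\overline S(\mu),d\}$, $\underline{\dim}_{\rm P}\pi^{\mathbf a}_*\mu\le\underline D(\mu)$ and $\overline{\dim}_{\rm P}\pi^{\mathbf a}_*\mu\le\overline D(\mu)$. (ii) Assume that $\|T_i\|<1/2$ for $1\le i\le m$. Then for Lebesgue-a.e. $\mathbf a\in\mathbb R^{md}$, $$\underline{\dim}_{\rm loc}(\pi^{\mathbf a}_*\mu,\pi^{\mathbf a}x)=\min\{S(\mu,x),d\}\quad\text{and}\quad \overline{\dim}_{\rm loc}(\pi^{\mathbf a}_*\mu,\pi^{\mathbf a}x)=D(\mu,x)\quad\text{for }\mu\text{-a.e. }x\in\Sigma,$$ and consequently, for Lebesgue-a.e. $\mathbf a\in\mathbb R^{md}$, $\underline{\dim}_{\rm H}\pi^{\mathbf a}_*\mu=\min\{\underline S(\mu),d\}$, $\overline{\dim}_{\rm H}\pi^{\mathbf a}_*\mu=\min\{\overline S(\mu),d\}$, $\underline{\dim}_{\rm P}\pi^{\mathbf a}_*\mu=\underline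 D(\mu)$ and $\overline{\dim}_{\rm P}\pi^{\mathbf a}_*\mu=\overline D(\mu)$. -/

import Mathlib

open MeasureTheory Filter Topology
open scoped ENNReal

noncomputable section

/-- The space `ℝ^d` with its Euclidean norm and Lebesgue measure. -/
abbrev Euc (d : ℕ) : Type := EuclideanSpace ℝ (Fin d)

/-- The symbolic space `Σ = {1, …, m}^ℕ`, with the product topology and its Borel σ-algebra.
Sequences are indexed from `0`. -/
abbrev Shift (m : ℕ) : Type := ℕ → Fin m

/-! ### Singular values and the singular value function -/

/-- The operator norm of a matrix with respect to the Euclidean norm. -/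
def opNorm {d : ℕ} (A : Matrix (Fin d) (Fin d) ℝ) : ℝ :=
  ‖Matrix.toEuclideanCLM (n := Fin d) (𝕜 := ℝ) A‖

/-- The singular values of `A` in decreasing order, with multiplicity, indexed from `0`: the usual
`α_k(A)` is `singVal A (k - 1)`. -/
def singVal {d : ℕ} (A : Matrix (Fin d) (Fin d) ℝ) (k : ℕ) : ℝ :=
  (Matrix.toEuclideanLin A).singularValues k

/-- The singular value function `φ^s(A)` for real `s ≥ 0`. -/
def svf {d : ℕ} (s : ℝ) (A : Matrix (Fin d) (Fin d) ℝ) : ℝ :=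
  if s < d then
    (∏ i ∈ Finset.range ⌊s⌋₊, singVal A i) * singVal A ⌊s⌋₊ ^ (s - (⌊s⌋₊ : ℝ))
  else |A.det| ^ (s / (d : ℝ))

/-- The singular value function for `s ∈ [0, ∞]`, with `φ^∞ = 0`. -/
def svfExt {d : ℕ} (s : ℝ≥0∞) (A : Matrix (Fin d) (Fin d) ℝ) : ℝ :=
  if s = ∞ then 0 else svf s.toReal A

/-! ### Words, the iterated function system and the coding map -/

/-- The product `T_{x|n} = T_{x_1} ⋯ T_{x_n}` along the first `n` symbols of `x`
(the identity for `n = 0`). -/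
def prefixProd {m d : ℕ} (T : Fin m → Matrix (Fin d) (Fin d) ℝ) (x : Shift m) :
    ℕ → Matrix (Fin d) (Fin d) ℝ
  | 0 => 1
  | n + 1 => prefixProd T x n * T (x n)

/-- The affine map `f_i^a(v) = T_i v + a_i`. -/
def ifsMap {m d : ℕ} (T : Fin m → Matrix (Fin d) (Fin d) ℝ) (a : Fin m → Euc d) (i : Fin m)
    (v : Euc d) : Euc d :=
  Matrix.toEuclideanCLM (n := Fin d) (𝕜 := ℝ) (T i) v + a i

/-- The composition `f_{x_1}^a ∘ ⋯ ∘ f_{x_n}^a`. -/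
def ifsComp {m d : ℕ} (T : Fin m → Matrix (Fin d) (Fin d) ℝ) (a : Fin m → Euc d) (x : Shift m) :
    ℕ → Euc d → Euc d
  | 0 => id
  | n + 1 => ifsComp T a x n ∘ ifsMap T a (x n)

/-- The coding map `π^a(x) = lim_{n → ∞} f_{x_1}^a ∘ ⋯ ∘ f_{x_n}^a (0)`. -/
def codingMap {m d : ℕ} (T : Fin m → Matrix (Fin d) (Fin d) ℝ) (a : Fin m → Euc d)
    (x : Shift m) : Euc d :=
  limUnder atTop (fun n : ℕ => ifsComp T a x n 0)

/-- The projection `π^a_* μ`. -/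
def projMeasure {m d : ℕ} (T : Fin m → Matrix (Fin d) (Fin d) ℝ) (a : Fin m → Euc d)
    (μ : Measure (Shift m)) : Measure (Euc d) :=
  μ.map (codingMap T a)

/-! ### Local dimensions and dimensions of measures

Here `ENNReal.log 0 = ⊥`, so the quotient is `⊤` if the ball is null and `0 < r < 1`. -/

/-- The lower local dimension `liminf_{r → 0} log η(B(x,r)) / log r`, with closed balls. -/
def lowerLocDim {X : Type*} [PseudoMetricSpace X] [MeasurableSpace X] (η : Measure X) (x : X) :
    EReal :=
  liminf (fun r : ℝ => ENNReal.log (η (Metric.closedBall x r)) / (Real.log r : EReal)) (𝓝[>] 0)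

/-- The upper local dimension `limsup_{r → 0} log η(B(x,r)) / log r`, with closed balls. -/
def upperLocDim {X : Type*} [PseudoMetricSpace X] [MeasurableSpace X] (η : Measure X) (x : X) :
    EReal :=
  limsup (fun r : ℝ => ENNReal.log (η (Metric.closedBall x r)) / (Real.log r : EReal)) (𝓝[>] 0)

/-- The lower Hausdorff dimension of a measure. -/
def lowerHausdorffDim {X : Type*} [PseudoMetricSpace X] [MeasurableSpace X] (η : Measure X) :
    EReal :=
  essInf (lowerLocDim η) η

/-- The upper Hausdorff dimension of a measure. -/
def upperHausdorffDim {X : Type*} [PseudoMetricSpace X] [MeasurableSpace X] (η : Measure X) :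
    EReal :=
  essSup (lowerLocDim η) η

/-- The lower packing dimension of a measure. -/
def lowerPackingDim {X : Type*} [PseudoMetricSpace X] [MeasurableSpace X] (η : Measure X) :
    EReal :=
  essInf (upperLocDim η) η

/-- The upper packing dimension of a measure. -/
def upperPackingDim {X : Type*} [PseudoMetricSpace X] [MeasurableSpace X] (η : Measure X) :
    EReal :=
  essSup (upperLocDim η) η

/-! ### The quantities `S(μ,x)` and `D(μ,x)` -/

/-- `S_n(μ,x)`: for `n ≥ 1` the unique `t ∈ [0,∞]` with `φ^t(T_{x|n}) = μ([x_1 ⋯ x_n])`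
(existence and uniqueness are `existsUnique_svfExt_prefixProd` below). -/
def Sn {m d : ℕ} (T : Fin m → Matrix (Fin d) (Fin d) ℝ) (μ : Measure (Shift m)) (x : Shift m)
    (n : ℕ) : ℝ≥0∞ :=
  sInf {t : ℝ≥0∞ | svfExt t (prefixProd T x n) = μ.real (PiNat.cylinder x n)}

/-- `S(μ,x) = liminf_{n → ∞} S_n(μ,x)`. -/
def Sloc {m d : ℕ} (T : Fin m → Matrix (Fin d) (Fin d) ℝ) (μ : Measure (Shift m))
    (x : Shift m) : ℝ≥0∞ :=
  liminf (fun n : ℕ => Sn T μ x n) atTop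

/-- The `μ`-essential infimum of `S(μ,·)`. -/
def Slower {m d : ℕ} (T : Fin m → Matrix (Fin d) (Fin d) ℝ) (μ : Measure (Shift m)) : ℝ≥0∞ :=
  essInf (Sloc T μ) μ

/-- The `μ`-essential supremum of `S(μ,·)`. -/
def Supper {m d : ℕ} (T : Fin m → Matrix (Fin d) (Fin d) ℝ) (μ : Measure (Shift m)) : ℝ≥0∞ :=
  essSup (Sloc T μ) μ

open Classical in
/-- `Z_{x ∧ y}(r)`. For `x ≠ y` the common initial segment `x ∧ y` is the prefix of `x` of length
`PiNat.firstDiff x y`, the first (`0`-based) index at which `x` and `y` differ. -/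
def Zfun {m d : ℕ} (T : Fin m → Matrix (Fin d) (Fin d) ℝ) (x y : Shift m) (r : ℝ) : ℝ :=
  if x = y then 1
  else ∏ k ∈ Finset.range d,
    min r (singVal (prefixProd T x (PiNat.firstDiff x y)) k) /
      singVal (prefixProd T x (PiNat.firstDiff x y)) k

/-- `G_μ(x,r) = ∫ Z_{x ∧ y}(r) dμ(y)`; the integrand takes values in `(0,1]`. -/
def Gfun {m d : ℕ} (T : Fin m → Matrix (Fin d) (Fin d) ℝ) (μ : Measure (Shift m)) (x : Shift m)
    (r : ℝ) : ℝ≥0∞ :=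
  ∫⁻ y, ENNReal.ofReal (Zfun T x y r) ∂μ

/-- `D(μ,x) = limsup_{r → 0} log G_μ(x,r) / log r`. -/
def Dloc {m d : ℕ} (T : Fin m → Matrix (Fin d) (Fin d) ℝ) (μ : Measure (Shift m))
    (x : Shift m) : EReal :=
  limsup (fun r : ℝ => ENNReal.log (Gfun T μ x r) / (Real.log r : EReal)) (𝓝[>] 0)

/-- The `μ`-essential infimum of `D(μ,·)`. -/
def Dlower {m d : ℕ} (T : Fin m → Matrix (Fin d) (Fin d) ℝ) (μ : Measure (Shift m)) : EReal :=
  essInf (Dloc T μ) μ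

/-- The `μ`-essential supremum of `D(μ,·)`. -/
def Dupper {m d : ℕ} (T : Fin m → Matrix (Fin d) (Fin d) ℝ) (μ : Measure (Shift m)) : EReal :=
  essSup (Dloc T μ) μ

/-! Existence and uniqueness of the number defining `S_n(μ,x)`. -/

theorem prod_singVal {d : ℕ} (A : Matrix (Fin d) (Fin d) ℝ) :
    ∏ i ∈ Finset.range d, singVal A i = |A.det| := by
  have h := LinearMap.normDet_eq_prod_singularValues (Matrix.toEuclideanLin A)
  rw [LinearMap.normDet_eq_abs_det, finrank_euclideanSpace, Fintype.card_fin] at h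
  have h2 : LinearMap.det (Matrix.toEuclideanLin A) = A.det := by
    change LinearMap.det (Matrix.toLpLin 2 2 A) = A.det
    rw [Matrix.toLpLin_eq_toLin, LinearMap.det_toLin]
  rw [h2] at h
  exact h.symm

theorem singVal_pos {d : ℕ} {A : Matrix (Fin d) (Fin d) ℝ} (hA : A.det ≠ 0) {i : ℕ}
    (hi : i < d) : 0 < singVal A i := by
  refine lt_of_le_of_ne (LinearMap.singularValues_nonneg _ _) fun h => hA ?_
  rw [← abs_eq_zero, ← prod_singVal]
  exact Finset.prod_eq_zero (Finset.mem_range.2 hi) h.symm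

theorem singVal_le_opNorm {d : ℕ} (A : Matrix (Fin d) (Fin d) ℝ) {i : ℕ} (hi : i < d) :
    singVal A i ≤ opNorm A := by
  have hi' : i < Module.finrank ℝ (EuclideanSpace ℝ (Fin d)) := by simpa using hi
  obtain ⟨v, hv⟩ := ((Matrix.toEuclideanLin A).hasEigenvalue_adjoint_comp_self_sq_singularValues
    hi').exists_hasEigenvector
  have h1 := hv.apply_eq_smul
  have hv0 : 0 < ‖v‖ := norm_pos_iff.2 hv.2
  have h2 : ‖Matrix.toEuclideanLin A v‖ ^ 2 = singVal A i ^ 2 * ‖v‖ ^ 2 := by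
    have h3 : inner ℝ ((LinearMap.adjoint (Matrix.toEuclideanLin A) ∘ₗ
        Matrix.toEuclideanLin A) v) v = singVal A i ^ 2 * ‖v‖ ^ 2 := by
      rw [h1]
      simp [inner_smul_left, singVal]
    rw [← h3, LinearMap.comp_apply, LinearMap.adjoint_inner_left, real_inner_self_eq_norm_sq]
  have h4 : ‖Matrix.toEuclideanLin A v‖ ≤ opNorm A * ‖v‖ := by
    rw [← Matrix.coe_toEuclideanCLM_eq_toEuclideanLin]
    exact (Matrix.toEuclideanCLM (n := Fin d) (𝕜 := ℝ) A).le_opNorm v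
  have h5 : singVal A i * ‖v‖ ≤ opNorm A * ‖v‖ := by
    refine le_trans (le_of_eq ?_) h4
    rw [← mul_pow] at h2
    exact ((sq_eq_sq₀ (norm_nonneg _)
      (mul_nonneg (LinearMap.singularValues_nonneg _ _) hv0.le)).1 h2).symm
  exact le_of_mul_le_mul_right h5 hv0

/-- The logarithm of the singular value function, written as a single sum. -/
def logSvf {d : ℕ} (A : Matrix (Fin d) (Fin d) ℝ) (s : ℝ) : ℝ :=
  ∑ i ∈ Finset.range d, (min 1 (max 0 (s - i)) + max 0 ((s - d) / d)) * Real.log (singVal A i)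

theorem svf_eq_exp {d : ℕ} {A : Matrix (Fin d) (Fin d) ℝ} (hA : A.det ≠ 0) {s : ℝ}
    (hs : 0 ≤ s) : svf s A = Real.exp (logSvf A s) := by
  have key : ∀ c : ℕ → ℝ, Real.exp (∑ i ∈ Finset.range d, c i * Real.log (singVal A i)) =
      ∏ i ∈ Finset.range d, singVal A i ^ c i := by
    intro c
    rw [Real.exp_sum]
    refine Finset.prod_congr rfl fun i hi => ?_
    rw [Real.rpow_def_of_pos (singVal_pos hA (Finset.mem_range.1 hi)), mul_comm]
  rw [logSvf, key, svf]
  split_ifs with h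
  · have hd : (0 : ℝ) < d := lt_of_le_of_lt hs h
    have hk : ⌊s⌋₊ < d := (Nat.floor_lt hs).2 h
    have h0 : max 0 ((s - d) / d) = 0 :=
      max_eq_left (div_nonpos_of_nonpos_of_nonneg (by linarith) hd.le)
    have hf1 := Nat.floor_le hs
    have hf2 := Nat.lt_floor_add_one s
    rw [h0, ← Finset.prod_range_mul_prod_Ico _ (Nat.succ_le_of_lt hk), Finset.prod_range_succ]
    have e1 : ∀ i ∈ Finset.range ⌊s⌋₊,
        singVal A i ^ (min 1 (max 0 (s - i)) + 0) = singVal A i := by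
      intro i hi
      have : (i : ℝ) + 1 ≤ ⌊s⌋₊ := by exact_mod_cast Finset.mem_range.1 hi
      rw [max_eq_right (by linarith), min_eq_left (by linarith), add_zero, Real.rpow_one]
    have e2 : ∀ i ∈ Finset.Ico (⌊s⌋₊ + 1) d,
        singVal A i ^ (min 1 (max 0 (s - i)) + 0) = 1 := by
      intro i hi
      have : (⌊s⌋₊ : ℝ) + 1 ≤ i := by exact_mod_cast (Finset.mem_Ico.1 hi).1
      rw [max_eq_left (by linarith), min_eq_right (by linarith), add_zero, Real.rpow_zero]
    rw [Finset.prod_congr rfl e1, Finset.prod_congr rfl e2, Finset.prod_const_one, mul_one,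
      max_eq_right (by linarith : (0 : ℝ) ≤ s - ⌊s⌋₊), min_eq_right (by linarith), add_zero]
  · push Not at h
    rw [← prod_singVal,
      ← Real.finsetProd_rpow _ _ (fun i hi => (singVal_pos hA (Finset.mem_range.1 hi)).le)]
    refine Finset.prod_congr rfl fun i hi => ?_
    have hi' : (i : ℝ) + 1 ≤ d := by exact_mod_cast Finset.mem_range.1 hi
    have hd : (0 : ℝ) < d := by have := Nat.cast_nonneg (α := ℝ) i; linarith
    rw [max_eq_right (by linarith), min_eq_left (by linarith),
      max_eq_right (div_nonneg (by linarith) hd.le), sub_div, div_self hd.ne']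
    congr 1
    ring

theorem continuous_logSvf {d : ℕ} (A : Matrix (Fin d) (Fin d) ℝ) : Continuous (logSvf A) := by
  unfold logSvf
  fun_prop

theorem logSvf_strictAntiOn {d : ℕ} (hd : 0 < d) {A : Matrix (Fin d) (Fin d) ℝ}
    (hA : A.det ≠ 0) (hA1 : opNorm A < 1) : StrictAntiOn (logSvf A) (Set.Ici 0) := by
  intro s hs t _ hst
  have hs : 0 ≤ s := hs
  have hd' : (0 : ℝ) < d := by exact_mod_cast hd
  have hlog : ∀ i, i < d → Real.log (singVal A i) < 0 := fun i hi =>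
    Real.log_neg (singVal_pos hA hi) ((singVal_le_opNorm A hi).trans_lt hA1)
  have m1 : ∀ i : ℕ, min 1 (max 0 (s - i)) ≤ min 1 (max 0 (t - i)) := fun i =>
    min_le_min le_rfl (max_le_max le_rfl (by linarith))
  have m2 : max 0 ((s - d) / d) ≤ max 0 ((t - d) / d) :=
    max_le_max le_rfl (div_le_div_of_nonneg_right (by linarith) hd'.le)
  refine Finset.sum_lt_sum (fun i hi => mul_le_mul_of_nonpos_right (add_le_add (m1 i) m2)
    (hlog i (Finset.mem_range.1 hi)).le) ?_
  by_cases h : s < d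
  · have hk : ⌊s⌋₊ < d := (Nat.floor_lt hs).2 h
    have hf1 := Nat.floor_le hs
    have hf2 := Nat.lt_floor_add_one s
    refine ⟨⌊s⌋₊, Finset.mem_range.2 hk, mul_lt_mul_of_neg_right (add_lt_add_of_lt_of_le ?_ m2)
      (hlog _ hk)⟩
    rw [max_eq_right (by linarith), max_eq_right (by linarith), min_eq_right (by linarith)]
    exact lt_min (by linarith) (by linarith)
  · push Not at h
    refine ⟨0, Finset.mem_range.2 hd, mul_lt_mul_of_neg_right (add_lt_add_of_le_of_lt (m1 0) ?_)
      (hlog 0 hd)⟩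
    rw [max_eq_right (div_nonneg (by linarith) hd'.le),
      max_eq_right (div_nonneg (by linarith) hd'.le)]
    exact div_lt_div_of_pos_right (by linarith) hd'

theorem existsUnique_svfExt {d : ℕ} (hd : 0 < d) {A : Matrix (Fin d) (Fin d) ℝ}
    (hA : A.det ≠ 0) (hA1 : opNorm A < 1) {c : ℝ} (hc0 : 0 ≤ c) (hc1 : c ≤ 1) :
    ∃! t : ℝ≥0∞, svfExt t A = c := by
  have hd' : (0 : ℝ) < d := by exact_mod_cast hd
  have hval : ∀ t : ℝ≥0∞, t ≠ ∞ → svfExt t A = Real.exp (logSvf A t.toReal) := fun t ht => by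
    rw [svfExt, if_neg ht, svf_eq_exp hA ENNReal.toReal_nonneg]
  refine existsUnique_of_exists_of_unique ?_ ?_
  · rcases hc0.eq_or_lt with rfl | hc
    · exact ⟨∞, if_pos rfl⟩
    have hdet : 0 < |A.det| := abs_pos.2 hA
    have hdet1 : Real.log |A.det| < 0 := by
      rw [← prod_singVal, Real.log_prod fun i hi => (singVal_pos hA (Finset.mem_range.1 hi)).ne']
      exact Finset.sum_neg (fun i hi => Real.log_neg (singVal_pos hA (Finset.mem_range.1 hi))
        ((singVal_le_opNorm A (Finset.mem_range.1 hi)).trans_lt hA1)) ⟨0, Finset.mem_range.2 hd⟩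
    have h0 : logSvf A 0 = 0 := by
      rw [← Real.exp_eq_one_iff, ← svf_eq_exp hA le_rfl]
      simp [svf, hd]
    obtain ⟨N, hN1, hN2⟩ : ∃ N : ℝ, (d : ℝ) ≤ N ∧ logSvf A N ≤ Real.log c := by
      refine ⟨max d (d * (Real.log c / Real.log |A.det|)), le_max_left _ _, ?_⟩
      set N := max (d : ℝ) (d * (Real.log c / Real.log |A.det|))
      have hN : (d : ℝ) ≤ N := le_max_left _ _
      have hN' : Real.log c / Real.log |A.det| ≤ N / d := by
        rw [le_div_iff₀ hd', mul_comm]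
        exact le_max_right _ _
      have e := svf_eq_exp hA (hd'.le.trans hN)
      rw [svf, if_neg (not_lt.2 hN)] at e
      have e2 := congrArg Real.log e
      rw [Real.log_exp, Real.log_rpow hdet] at e2
      rw [← e2]
      calc N / d * Real.log |A.det| ≤ Real.log c / Real.log |A.det| * Real.log |A.det| :=
            mul_le_mul_of_nonpos_right hN' hdet1.le
        _ = Real.log c := div_mul_cancel₀ _ hdet1.ne
    obtain ⟨t, ht, hte⟩ := intermediate_value_Icc' (hd'.le.trans hN1)
      (continuous_logSvf A).continuousOn
      (show Real.log c ∈ Set.Icc (logSvf A N) (logSvf A 0) from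
        ⟨hN2, h0.symm ▸ Real.log_nonpos hc0 hc1⟩)
    refine ⟨ENNReal.ofReal t, ?_⟩
    rw [hval _ ENNReal.ofReal_ne_top, ENNReal.toReal_ofReal ht.1, hte, Real.exp_log hc]
  · intro s t hs ht
    by_cases h1 : s = ∞ <;> by_cases h2 : t = ∞
    · rw [h1, h2]
    · rw [← ht, hval t h2, svfExt, if_pos h1] at hs
      exact absurd hs (Real.exp_pos _).ne
    · rw [← hs, hval s h1, svfExt, if_pos h2] at ht
      exact absurd ht (Real.exp_pos _).ne
    · rw [← ht, hval s h1, hval t h2, Real.exp_eq_exp] at hs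
      exact (ENNReal.toReal_eq_toReal_iff' h1 h2).1
        ((logSvf_strictAntiOn hd hA hA1).injOn ENNReal.toReal_nonneg ENNReal.toReal_nonneg hs)

theorem opNorm_mul_le {d : ℕ} (A B : Matrix (Fin d) (Fin d) ℝ) :
    opNorm (A * B) ≤ opNorm A * opNorm B := by
  unfold opNorm
  rw [map_mul]
  exact norm_mul_le _ _

theorem existsUnique_svfExt_prefixProd {m d : ℕ} (hd : 0 < d)
    (T : Fin m → Matrix (Fin d) (Fin d) ℝ) (hT : ∀ i, (T i).det ≠ 0)
    (hT1 : ∀ i, opNorm (T i) < 1) (μ : Measure (Shift m)) [IsProbabilityMeasure μ]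
    (x : Shift m) {n : ℕ} (hn : 0 < n) :
    ∃! t : ℝ≥0∞, svfExt t (prefixProd T x n) = μ.real (PiNat.cylinder x n) := by
  refine existsUnique_svfExt hd ?_ ?_ measureReal_nonneg measureReal_le_one
  · clear hn
    induction n with
    | zero => simp [prefixProd]
    | succ n ih => rw [prefixProd, Matrix.det_mul]; exact mul_ne_zero ih (hT _)
  · have h1 : ∀ k, opNorm (prefixProd T x k) ≤ 1 := by
      intro k
      induction k with
      | zero =>
        simp only [prefixProd, opNorm, map_one]
        exact ContinuousLinearMap.norm_id_le
      | succ k ih =>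
        exact (opNorm_mul_le _ _).trans (mul_le_one₀ ih (norm_nonneg _) (hT1 _).le)
    obtain ⟨k, rfl⟩ : ∃ k, n = k + 1 := ⟨n - 1, by omega⟩
    exact (opNorm_mul_le _ _).trans_lt
      ((mul_le_of_le_one_left (norm_nonneg _) (h1 k)).trans_lt (hT1 _))

end

/-! ### Logarithmic quotients and dyadic scales -/

noncomputable section

/-! Write η for the projection of μ and Z(A, r) for `truncRatio A r`, the product of min(r,
α_k)/α_k. Two points with common prefix x|n have codes that differ by T_{x|n} applied to a vector in
a fixed ball (`codingMap_sub`). Z(T_{x|n}, r) plays two roles. About 1/Z cells of diameter r cover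
the image of a ball under T_{x|n} (`exists_cells`), and Z bounds the volume of the vectors in a ball
that T_{x|n} maps into the r-ball (`volume_ellipsoid_le`). The first role gives the upper bounds,
the second the lower ones.

Upper bounds, for every a. Cut the cylinder [x|n] by the cells. A cell containing a point y with
η(B(πy, r)) < c Z μ[x|n] has less than this mass, and there are at most const/Z cells, so such y
fill a fraction at most const·c of the cylinder. Take r = 2^{-j}, n ≤ Kj, c = (j+1)^{-3}. By
Borel–Cantelli, almost every x eventually satisfies Z(T_{x|n}, r) μ[x|n] ≤ (j+1)^3 η(B(πx, r)) for
all these n. Prefixes longer than Kj contract below r, so G_μ(x, r) is at most the sum of the left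
sides (`Gfun_le_sum`), and the bound by D follows. If S(μ,x) < s < d, then φ^s(T_{x|n}) ≤ μ[x|n] for
infinitely many n. At r close to α_{⌊s⌋+1}(T_{x|n}) one has Z φ^s ≥ 2^{-d} r^s, which bounds the
lower local dimension. The bound by d comes from n = 0.

Lower bounds, for almost every a. Transversality says that the translations in a bounded box with
|πx − πy| ≤ r have measure at most C Z_{x∧y}(r) (`exists_transversality`). After the common prefix
is removed, the first letters differ. Changing the translation of a suitable one of these two
letters moves the difference of the tails by ±Id plus an operator of norm at most ρ/(1−ρ), which is
below 1 exactly when ρ < 1/2. Integrating in y, the mean over a of η(B(πx, r)) is at most C G_μ(x,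
r). Markov, Borel–Cantelli and Fubini then give η(B(πx, 2^{-j})) ≤ (j+1)^2 G_μ(x, 2^{-j})
eventually. This yields D at once. Finally Z φ^s ≤ r^s always, so G_μ has lower exponent at least
min(S, d) (`min_Sloc_le_liminf`).

Polynomial factors in j do not affect the exponents, and monotonicity in r reduces everything to
dyadic scales. -/

theorem log_div_log_le_iff {r : ℝ} (h0 : 0 < r) (h1 : r < 1) {u : ℝ≥0∞} {t : ℝ} :
    ENNReal.log u / (Real.log r : EReal) ≤ (t : EReal) ↔ ENNReal.ofReal (r ^ t) ≤ u := by
  have hl : Real.log r < 0 := Real.log_neg h0 h1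
  have hl' : (Real.log r : EReal) < 0 := by exact_mod_cast hl
  -- The number t is itself the quotient for r^t, and dividing by the negative log r reverses the
  -- order.
  have h : (t : EReal) = ENNReal.log (ENNReal.ofReal (r ^ t)) / (Real.log r : EReal) := by
    rw [ENNReal.log_ofReal_of_pos (Real.rpow_pos_of_pos h0 _), Real.log_rpow h0, ← EReal.coe_div,
      mul_div_cancel_right₀ _ hl.ne]
  rw [h, (EReal.strictAnti_div_right_of_neg hl' (EReal.coe_ne_bot _)).le_iff_ge,
    ENNReal.log_le_log_iff]

theorem le_log_div_log_iff {r : ℝ} (h0 : 0 < r) (h1 : r < 1) {u : ℝ≥0∞} {t : ℝ} :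
    (t : EReal) ≤ ENNReal.log u / (Real.log r : EReal) ↔ u ≤ ENNReal.ofReal (r ^ t) := by
  have hl : Real.log r < 0 := Real.log_neg h0 h1
  have hl' : (Real.log r : EReal) < 0 := by exact_mod_cast hl
  have h : (t : EReal) = ENNReal.log (ENNReal.ofReal (r ^ t)) / (Real.log r : EReal) := by
    rw [ENNReal.log_ofReal_of_pos (Real.rpow_pos_of_pos h0 _), Real.log_rpow h0, ← EReal.coe_div,
      mul_div_cancel_right₀ _ hl.ne]
  rw [h, (EReal.strictAnti_div_right_of_neg hl' (EReal.coe_ne_bot _)).le_iff_ge,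
    ENNReal.log_le_log_iff]

/-- The dyadic scale `2^{-j}`. -/
def dyad (j : ℕ) : ℝ := (1 / 2) ^ j

theorem dyad_pos (j : ℕ) : 0 < dyad j := by unfold dyad; positivity

theorem dyad_le_one (j : ℕ) : dyad j ≤ 1 := pow_le_one₀ (by norm_num) (by norm_num)

theorem dyad_lt_one {j : ℕ} (hj : j ≠ 0) : dyad j < 1 :=
  pow_lt_one₀ (by norm_num) (by norm_num) hj

theorem dyad_succ (j : ℕ) : dyad (j + 1) = dyad j / 2 := by rw [dyad, dyad, pow_succ]; ring

theorem tendsto_dyad : Tendsto dyad atTop (𝓝[>] 0) :=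
  tendsto_nhdsWithin_iff.2 ⟨tendsto_pow_atTop_nhds_zero_of_lt_one (by norm_num) (by norm_num),
    Eventually.of_forall dyad_pos⟩

theorem dyad_rpow (j : ℕ) (s : ℝ) : dyad j ^ s = (1 / 2 : ℝ) ^ (j * s) := by
  rw [dyad, ← Real.rpow_natCast, ← Real.rpow_mul (by norm_num)]

/-- The quotient `log u_j / log 2^{-j}`. -/
def dyadicRatio (u : ℕ → ℝ≥0∞) (j : ℕ) : EReal :=
  ENNReal.log (u j) / (Real.log (dyad j) : EReal)

theorem exists_dyad_near {r : ℝ} (h0 : 0 < r) {J : ℕ} (h : r ≤ dyad J) :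
    ∃ j, J ≤ j ∧ dyad (j + 1) < r ∧ r ≤ dyad j := by
  obtain ⟨n, h1, h2⟩ := exists_nat_pow_near_of_lt_one h0 (h.trans (dyad_le_one J))
    (by norm_num : (0 : ℝ) < 1 / 2) (by norm_num)
  refine ⟨n, ?_, h1, h2⟩
  by_contra! hn
  have : dyad J ≤ dyad (n + 1) := pow_le_pow_of_le_one (by norm_num) (by norm_num) hn
  exact absurd (h.trans this) (not_le.2 h1)

theorem eventually_nhdsGT_of_dyad {p : ℝ → Prop} {q : ℕ → Prop} (hq : ∀ᶠ j in atTop, q j)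
    (h : ∀ j r, q j → dyad (j + 1) < r → r ≤ dyad j → 0 < r → p r) : ∀ᶠ r in 𝓝[>] 0, p r := by
  obtain ⟨J, hJ⟩ := eventually_atTop.1 hq
  filter_upwards [Ioc_mem_nhdsGT (dyad_pos J)] with r hr
  obtain ⟨j, hj, h1, h2⟩ := exists_dyad_near hr.1 hr.2
  exact h j r (hJ j hj) h1 h2 hr.1

/-- Passing to the next scale costs a factor 2^{-s}, which the gap t − s absorbs once j(t − s) ≥ s.
-/
theorem rpow_dyad_le_rpow_dyad {s t : ℝ} (hst : s < t) :
    ∀ᶠ j : ℕ in atTop, dyad j ^ t ≤ dyad (j + 1) ^ s := by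
  filter_upwards [eventually_ge_atTop ⌈s / (t - s)⌉₊] with j hj
  rw [dyad_rpow, dyad_rpow]
  apply Real.rpow_le_rpow_of_exponent_ge (by norm_num) (by norm_num)
  have := (Nat.le_ceil _).trans (Nat.cast_le (α := ℝ).2 hj)
  rw [div_le_iff₀ (by linarith)] at this
  push_cast
  linarith

/-- Monotonicity traps g(r) between its values at the two neighbouring dyadic scales, and a factor 2
in r does not change the exponent. Only r > 0 is required, since `Gfun` is controlled only there. -/
theorem liminf_log_div_log_eq {g : ℝ → ℝ≥0∞} (hg : MonotoneOn g (Set.Ioi 0)) (hg1 : ∀ r, 0 < r → g r ≤ 1) :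
    liminf (fun r : ℝ => ENNReal.log (g r) / (Real.log r : EReal)) (𝓝[>] 0) =
      liminf (dyadicRatio fun j => g (dyad j)) atTop := by
  refine le_antisymm ?_ ?_
  · exact (liminf_le_liminf_of_le tendsto_dyad).trans (le_of_eq rfl)
  · refine EReal.ge_of_forall_gt_iff_ge.1 fun s hs => ?_
    obtain ⟨t, hst, ht⟩ := EReal.lt_iff_exists_real_btwn.1 hs
    have hst : s < t := by exact_mod_cast hst
    refine le_liminf_of_le (by isBoundedDefault) ?_
    refine eventually_nhdsGT_of_dyad (((eventually_lt_of_lt_liminf ht).and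
      (rpow_dyad_le_rpow_dyad hst)).and (eventually_gt_atTop 0)) ?_
    rintro j r ⟨⟨hj1, hj2⟩, hj0⟩ hr1 hr2 hr0
    have hr : r < 1 := hr2.trans_lt (dyad_lt_one hj0.ne')
    rw [le_log_div_log_iff hr0 hr]
    -- For negative s the power r^s is no longer increasing in r, but then r^s ≥ 1 ≥ g(r).
    rcases lt_or_ge s 0 with h | h
    · refine (hg1 r hr0).trans ?_
      rw [ENNReal.one_le_ofReal]
      exact Real.one_le_rpow_of_pos_of_le_one_of_nonpos hr0 hr.le h.le
    · refine (hg hr0 (dyad_pos j) hr2).trans (((le_log_div_log_iff (dyad_pos j) (dyad_lt_one hj0.ne')).1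
        hj1.le).trans (ENNReal.ofReal_le_ofReal (hj2.trans ?_)))
      exact Real.rpow_le_rpow (dyad_pos _).le hr1.le h

theorem limsup_log_div_log_eq {g : ℝ → ℝ≥0∞} (hg : MonotoneOn g (Set.Ioi 0)) (hg1 : ∀ r, 0 < r → g r ≤ 1) :
    limsup (fun r : ℝ => ENNReal.log (g r) / (Real.log r : EReal)) (𝓝[>] 0) =
      limsup (dyadicRatio fun j => g (dyad j)) atTop := by
  refine le_antisymm ?_ ?_
  · refine EReal.le_of_forall_lt_iff_le.1 fun s hs => ?_
    obtain ⟨t, ht, hst⟩ := EReal.lt_iff_exists_real_btwn.1 hs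
    have hst : t < s := by exact_mod_cast hst
    have hev := eventually_lt_of_limsup_lt ht
    refine limsup_le_of_le (by isBoundedDefault) ?_
    refine eventually_nhdsGT_of_dyad (((((tendsto_add_atTop_nat 1).eventually hev).and
      (rpow_dyad_le_rpow_dyad hst))).and (eventually_gt_atTop 0)) ?_
    rintro j r ⟨⟨hj1, hj2⟩, hj0⟩ hr1 hr2 hr0
    have hr : r < 1 := hr2.trans_lt (dyad_lt_one hj0.ne')
    rw [log_div_log_le_iff hr0 hr]
    have h1 := (log_div_log_le_iff (dyad_pos _) (dyad_lt_one j.succ_ne_zero)).1 hj1.le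
    -- Since g ≤ 1, the quotients are nonnegative, so t ≥ 0; this makes r^s monotone in r below.
    have ht0 : 0 ≤ t := by
      by_contra! h
      have := h1.trans (hg1 _ (dyad_pos _))
      rw [ENNReal.ofReal_le_one] at this
      exact absurd this (not_le.2 (Real.one_lt_rpow_of_pos_of_lt_one_of_neg (dyad_pos _)
        (dyad_lt_one j.succ_ne_zero) h))
    refine le_trans (ENNReal.ofReal_le_ofReal ?_) (h1.trans (hg (dyad_pos _) hr0 hr1.le))
    exact (Real.rpow_le_rpow hr0.le hr2 (ht0.trans hst.le)).trans hj2
  · exact limsup_le_limsup_of_le (u := fun r : ℝ => ENNReal.log (g r) / (Real.log r : EReal))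
      tendsto_dyad (by isBoundedDefault) (by isBoundedDefault)

theorem tendsto_poly_mul_rpow_dyad (C : ℝ) (p : ℕ) {ε : ℝ} (hε : 0 < ε) :
    Tendsto (fun j : ℕ => C * ((j : ℝ) + 1) ^ p * dyad j ^ ε) atTop (𝓝 0) := by
  have h1 : Tendsto (fun n : ℕ => (n : ℝ) ^ p * ((1 / 2 : ℝ) ^ ε) ^ n) atTop (𝓝 0) :=
    tendsto_pow_const_mul_const_pow_of_abs_lt_one p (by
      rw [abs_of_pos (by positivity)]
      exact Real.rpow_lt_one (by norm_num) (by norm_num) hε)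
  have h2 := ((tendsto_add_atTop_iff_nat 1).2 h1).const_mul (C * ((1 / 2 : ℝ) ^ ε)⁻¹)
  rw [mul_zero] at h2
  refine h2.congr fun j => ?_
  rw [dyad_rpow, mul_comm (j : ℝ) ε, Real.rpow_mul_natCast (by norm_num), pow_succ]
  push_cast
  field_simp

/-- The polynomial factor is swallowed by 2^{-j(t−s)}. The scale-by-scale implication serves both
liminf (frequently) and limsup (eventually). The larger sequence has the smaller ratio, because log
2^{-j} < 0. -/
theorem dyadicRatio_le_of_le {u v : ℕ → ℝ≥0∞} {C : ℝ} {p : ℕ}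
    (h : ∀ᶠ j : ℕ in atTop, u j ≤ ENNReal.ofReal (C * (j + 1) ^ p) * v j) {s t : ℝ}
    (hst : s < t) : ∀ᶠ j in atTop, dyadicRatio u j < s → dyadicRatio v j ≤ t := by
  have h2 := (tendsto_poly_mul_rpow_dyad C p (sub_pos.2 hst)).eventually_le_const one_pos
  filter_upwards [h, h2, eventually_gt_atTop 0] with j hj1 hj2 hj0 hu
  rw [dyadicRatio, log_div_log_le_iff (dyad_pos j) (dyad_lt_one hj0.ne')]
  have h3 := (log_div_log_le_iff (dyad_pos j) (dyad_lt_one hj0.ne')).1 hu.le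
  calc ENNReal.ofReal (dyad j ^ t)
      = ENNReal.ofReal (dyad j ^ (t - s)) * ENNReal.ofReal (dyad j ^ s) := by
        rw [← ENNReal.ofReal_mul (Real.rpow_nonneg (dyad_pos j).le _),
          ← Real.rpow_add (dyad_pos j), sub_add_cancel]
    _ ≤ ENNReal.ofReal (dyad j ^ (t - s)) * (ENNReal.ofReal (C * (j + 1) ^ p) * v j) := by
        gcongr
        exact h3.trans hj1
    _ = ENNReal.ofReal (C * (j + 1) ^ p * dyad j ^ (t - s)) * v j := by
        rw [← mul_assoc, ← ENNReal.ofReal_mul (Real.rpow_nonneg (dyad_pos j).le _), mul_comm (C * _)]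
    _ ≤ 1 * v j := by
        gcongr
        exact ENNReal.ofReal_le_one.2 hj2
    _ = v j := one_mul _

theorem liminf_dyadicRatio_le {u v : ℕ → ℝ≥0∞} {C : ℝ} {p : ℕ}
    (h : ∀ᶠ j : ℕ in atTop, u j ≤ ENNReal.ofReal (C * (j + 1) ^ p) * v j) :
    liminf (dyadicRatio v) atTop ≤ liminf (dyadicRatio u) atTop := by
  refine EReal.le_of_forall_lt_iff_le.1 fun s hs => ?_
  obtain ⟨t, ht, hst⟩ := EReal.lt_iff_exists_real_btwn.1 hs
  refine liminf_le_of_frequently_le ?_ (by isBoundedDefault)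
  exact (frequently_lt_of_liminf_lt (by isBoundedDefault) ht).mp
    (dyadicRatio_le_of_le h (by exact_mod_cast hst))

theorem limsup_dyadicRatio_le {u v : ℕ → ℝ≥0∞} {C : ℝ} {p : ℕ}
    (h : ∀ᶠ j : ℕ in atTop, u j ≤ ENNReal.ofReal (C * (j + 1) ^ p) * v j) :
    limsup (dyadicRatio v) atTop ≤ limsup (dyadicRatio u) atTop := by
  refine EReal.le_of_forall_lt_iff_le.1 fun s hs => ?_
  obtain ⟨t, ht, hst⟩ := EReal.lt_iff_exists_real_btwn.1 hs
  refine limsup_le_of_le (by isBoundedDefault) ?_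
  exact (eventually_lt_of_limsup_lt ht).mp (dyadicRatio_le_of_le h (by exact_mod_cast hst))

/-! ### Local dimensions at dyadic scales and their measurability -/

section LocalDimension

variable {X : Type*} [PseudoMetricSpace X] [MeasurableSpace X]

theorem monotone_measure_closedBall (η : Measure X) (z : X) :
    Monotone fun r => η (Metric.closedBall z r) :=
  fun _ _ h => measure_mono (Metric.closedBall_subset_closedBall h)

theorem lowerLocDim_eq (η : Measure X) [IsProbabilityMeasure η] (z : X) :
    lowerLocDim η z = liminf (dyadicRatio fun j => η (Metric.closedBall z (dyad j))) atTop :=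
  liminf_log_div_log_eq ((monotone_measure_closedBall η z).monotoneOn _) fun _ _ => prob_le_one

theorem upperLocDim_eq (η : Measure X) [IsProbabilityMeasure η] (z : X) :
    upperLocDim η z = limsup (dyadicRatio fun j => η (Metric.closedBall z (dyad j))) atTop :=
  limsup_log_div_log_eq ((monotone_measure_closedBall η z).monotoneOn _) fun _ _ => prob_le_one

theorem measurable_dyadicRatio {Y : Type*} [MeasurableSpace Y] {g : Y → ℕ → ℝ≥0∞} (j : ℕ)
    (hg : Measurable fun z => g z j) : Measurable fun z => dyadicRatio (g z) j := by
  have h0 : (Real.log (dyad j) : EReal) ≤ 0 := by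
    exact_mod_cast Real.log_nonpos (dyad_pos j).le (dyad_le_one j)
  exact (EReal.antitone_div_right_of_nonpos h0).measurable.comp hg.ennreal_log

variable [OpensMeasurableSpace X] [SecondCountableTopology X]

theorem measurable_measure_closedBall (η : Measure X) [SFinite η] (r : ℝ) :
    Measurable fun z => η (Metric.closedBall z r) :=
  measurable_measure_prodMk_left (ν := η) (s := {p : X × X | dist p.2 p.1 ≤ r})
    (measurableSet_le (by fun_prop) measurable_const)

/-- Dyadic scales turn the liminf over all r into a countable one, so measurability passes to the
limit. -/
theorem measurable_lowerLocDim (η : Measure X) [IsProbabilityMeasure η] :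
    Measurable (lowerLocDim η) := by
  rw [funext (lowerLocDim_eq η)]
  exact Measurable.liminf fun j =>
    measurable_dyadicRatio (g := fun z j => η (Metric.closedBall z (dyad j))) j
      (measurable_measure_closedBall η _)

theorem measurable_upperLocDim (η : Measure X) [IsProbabilityMeasure η] :
    Measurable (upperLocDim η) := by
  rw [funext (upperLocDim_eq η)]
  exact Measurable.limsup fun j =>
    measurable_dyadicRatio (g := fun z j => η (Metric.closedBall z (dyad j))) j
      (measurable_measure_closedBall η _)

end LocalDimension

/-! ### Essential bounds under push-forward and truncation -/

theorem essSup_map_eq {X Y : Type*} [MeasurableSpace X] [MeasurableSpace Y] {μ : Measure X}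
    {f : X → Y} {g : Y → EReal} (hf : Measurable f) (hg : Measurable g) :
    essSup g (μ.map f) = essSup (g ∘ f) μ :=
  essSup_map_measure hg.aemeasurable hf.aemeasurable

theorem essInf_map_eq {X Y : Type*} [MeasurableSpace X] [MeasurableSpace Y] {μ : Measure X}
    {f : X → Y} {g : Y → EReal} (hf : Measurable f) (hg : Measurable g) :
    essInf g (μ.map f) = essInf (g ∘ f) μ := by
  rw [essInf_eq_sSup, essInf_eq_sSup]
  congr 1
  ext c
  simp only [Set.mem_ofPred_eq]
  rw [Measure.map_apply hf (measurableSet_lt hg measurable_const)]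
  rfl

/-- The essential infimum is a liminf along `ae μ`, which commutes with continuous monotone maps
when this filter is proper; `NeZero μ` ensures that. -/
theorem essInf_coe_min {X : Type*} [MeasurableSpace X] (μ : Measure X) [NeZero μ]
    (f : X → ℝ≥0∞) (c : ℝ≥0∞) :
    essInf (fun x => ((min (f x) c : ℝ≥0∞) : EReal)) μ = ((min (essInf f μ) c : ℝ≥0∞) : EReal) :=
  (Monotone.map_liminf_of_continuousAt (F := ae μ) (f := fun t : ℝ≥0∞ => ((min t c : ℝ≥0∞) : EReal))
    (fun _ _ h => EReal.coe_ennreal_le_coe_ennreal_iff.2 (min_le_min_right _ h)) f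
    (continuous_coe_ennreal_ereal.comp (continuous_id.min continuous_const)).continuousAt).symm

theorem essSup_coe_min {X : Type*} [MeasurableSpace X] (μ : Measure X) [NeZero μ]
    (f : X → ℝ≥0∞) (c : ℝ≥0∞) :
    essSup (fun x => ((min (f x) c : ℝ≥0∞) : EReal)) μ = ((min (essSup f μ) c : ℝ≥0∞) : EReal) :=
  (Monotone.map_limsup_of_continuousAt (F := ae μ) (f := fun t : ℝ≥0∞ => ((min t c : ℝ≥0∞) : EReal))
    (fun _ _ h => EReal.coe_ennreal_le_coe_ennreal_iff.2 (min_le_min_right _ h)) f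
    (continuous_coe_ennreal_ereal.comp (continuous_id.min continuous_const)).continuousAt).symm

/-! ### Singular values, coverings and volumes -/

section SingularValues

variable {d : ℕ}

/-- Diagonalise the adjoint of A composed with A. In this eigenbasis, A stretches the k-th axis by
α_k, so covering and volume become one-dimensional questions. -/
theorem exists_orthonormalBasis_norm_sq_eq (A : Matrix (Fin d) (Fin d) ℝ) :
    ∃ v : OrthonormalBasis (Fin d) ℝ (Euc d), ∀ u : Euc d,
      ‖Matrix.toEuclideanCLM (n := Fin d) (𝕜 := ℝ) A u‖ ^ 2 =
        ∑ k : Fin d, (singVal A k * v.repr u k) ^ 2 := by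
  set L := Matrix.toEuclideanLin A with hL
  have hfr : Module.finrank ℝ (Euc d) = d := by simp
  have hs := L.isSymmetric_adjoint_comp_self
  refine ⟨hs.eigenvectorBasis hfr, fun u => ?_⟩
  set v := hs.eigenvectorBasis hfr with hv
  have h1 : ‖Matrix.toEuclideanCLM (n := Fin d) (𝕜 := ℝ) A u‖ ^ 2 =
      inner ℝ ((LinearMap.adjoint L ∘ₗ L) u) u := by
    rw [LinearMap.comp_apply, LinearMap.adjoint_inner_left, real_inner_self_eq_norm_sq, hL,
      ← Matrix.coe_toEuclideanCLM_eq_toEuclideanLin]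
    rfl
  rw [h1, ← v.repr.inner_map_map, PiLp.inner_apply]
  refine Finset.sum_congr rfl fun k _ => ?_
  rw [hs.eigenvectorBasis_apply_self_apply hfr u k, ← L.sq_singularValues_fin hfr k]
  simp [singVal, hL]
  ring

/-- The ratio `∏_k min (r, α_k(A)) / α_k(A)`. -/
def truncRatio (A : Matrix (Fin d) (Fin d) ℝ) (r : ℝ) : ℝ :=
  ∏ k ∈ Finset.range d, min r (singVal A k) / singVal A k

variable {A : Matrix (Fin d) (Fin d) ℝ}

theorem truncRatio_nonneg (hA : A.det ≠ 0) {r : ℝ} (hr : 0 ≤ r) : 0 ≤ truncRatio A r :=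
  Finset.prod_nonneg fun _ hk =>
    have := singVal_pos hA (Finset.mem_range.1 hk)
    div_nonneg (le_min hr this.le) this.le

theorem truncRatio_le_one (hA : A.det ≠ 0) {r : ℝ} (hr : 0 ≤ r) : truncRatio A r ≤ 1 :=
  Finset.prod_le_one (fun _ hk =>
    have := singVal_pos hA (Finset.mem_range.1 hk)
    div_nonneg (le_min hr this.le) this.le) fun _ hk =>
    div_le_one_of_le₀ (min_le_right _ _) (singVal_pos hA (Finset.mem_range.1 hk)).le

theorem truncRatio_mono (hA : A.det ≠ 0) {r s : ℝ} (hr : 0 ≤ r) (h : r ≤ s) :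
    truncRatio A r ≤ truncRatio A s :=
  Finset.prod_le_prod (fun _ hk =>
    have := singVal_pos hA (Finset.mem_range.1 hk)
    div_nonneg (le_min hr this.le) this.le) fun _ hk =>
    div_le_div_of_nonneg_right (min_le_min_right _ h) (singVal_pos hA (Finset.mem_range.1 hk)).le

theorem truncRatio_eq_one (hA : A.det ≠ 0) {r : ℝ} (h : opNorm A ≤ r) : truncRatio A r = 1 :=
  Finset.prod_eq_one fun k hk => by
    rw [min_eq_right ((singVal_le_opNorm A (Finset.mem_range.1 hk)).trans h),
      div_self (singVal_pos hA (Finset.mem_range.1 hk)).ne']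

theorem truncRatio_le_div_pow {r : ℝ} (hr : 0 ≤ r) :
    truncRatio A r ≤ r ^ d / |A.det| := by
  rw [← prod_singVal, truncRatio, Finset.prod_div_distrib]
  refine div_le_div_of_nonneg_right ?_ (Finset.prod_nonneg fun k _ =>
    LinearMap.singularValues_nonneg _ _)
  calc ∏ k ∈ Finset.range d, min r (singVal A k) ≤ ∏ _k ∈ Finset.range d, r :=
        Finset.prod_le_prod (fun k _ => le_min hr (LinearMap.singularValues_nonneg _ _))
          fun k _ => min_le_left _ _
    _ = r ^ d := by simp

/-- For r and α in [0, 1] both r and α are at least rα, so every factor is at least r. -/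
theorem pow_le_truncRatio (hA : A.det ≠ 0) (hA1 : opNorm A ≤ 1) {r : ℝ} (hr : 0 ≤ r)
    (hr1 : r ≤ 1) : r ^ d ≤ truncRatio A r := by
  calc r ^ d = ∏ _k ∈ Finset.range d, r := by simp
    _ ≤ _ := Finset.prod_le_prod (fun _ _ => hr) fun k hk => by
      have h := singVal_pos hA (Finset.mem_range.1 hk)
      have h1 := (singVal_le_opNorm A (Finset.mem_range.1 hk)).trans hA1
      rw [le_div_iff₀ h]
      exact le_min (mul_le_of_le_one_right hr h1) (mul_le_of_le_one_left h.le hr1)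

/-- For s in [0, d] the exponents of the singular values in φ^s add up to s, so r^s splits into
factors matching those of φ^s. -/
theorem sum_min_one_max_zero (n : ℕ) (s : ℝ) :
    ∑ i ∈ Finset.range n, min 1 (max 0 (s - i)) = max 0 (min s n) := by
  induction n with
  | zero => simp
  | succ n ih =>
    rw [Finset.sum_range_succ, ih]
    have := Nat.cast_nonneg (α := ℝ) n
    push_cast
    rcases le_total s n with h | h
    · rw [min_eq_left h, max_eq_left (b := s - n) (by linarith), min_eq_right zero_le_one,
        min_eq_left (by linarith), add_zero]
    · rw [min_eq_right h, max_eq_right (b := s - n) (by linarith), max_eq_right this]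
      rcases le_total s (n + 1) with h' | h'
      · rw [min_eq_right (by linarith), min_eq_left h', max_eq_right (by linarith)]
        ring
      · rw [min_eq_left (by linarith), min_eq_right h', max_eq_right (by linarith)]

theorem svf_eq_prod (hA : A.det ≠ 0) {s : ℝ} (hs : 0 ≤ s) (hsd : s < d) :
    svf s A = ∏ i ∈ Finset.range d, singVal A i ^ min 1 (max 0 (s - i)) := by
  rw [svf_eq_exp hA hs, logSvf, Real.exp_sum]
  refine Finset.prod_congr rfl fun i hi => ?_
  rw [max_eq_left (a := (0 : ℝ)) (b := (s - d) / d)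
    (div_nonpos_of_nonpos_of_nonneg (by linarith) (Nat.cast_nonneg d)), add_zero,
    Real.rpow_def_of_pos (singVal_pos hA (Finset.mem_range.1 hi)), mul_comm]

theorem prod_rpow_eq {r : ℝ} (hr : 0 < r) {s : ℝ} (hs : 0 ≤ s) (hsd : s < d) :
    ∏ i ∈ Finset.range d, r ^ min 1 (max 0 (s - i)) = r ^ s := by
  rw [← Real.rpow_sum_of_pos hr, sum_min_one_max_zero, min_eq_left hsd.le, max_eq_right hs]

/-- Factor by factor, with t = r/α and exponent c in [0, 1], this is min(1, t) ≤ t^c. -/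
theorem truncRatio_mul_svf_le (hA : A.det ≠ 0) {r : ℝ} (hr : 0 < r) {s : ℝ} (hs : 0 ≤ s)
    (hsd : s < d) : truncRatio A r * svf s A ≤ r ^ s := by
  rw [svf_eq_prod hA hs hsd, ← prod_rpow_eq hr hs hsd, truncRatio, ← Finset.prod_mul_distrib]
  refine Finset.prod_le_prod (fun k hk => ?_) fun k hk => ?_
  all_goals have h := singVal_pos hA (Finset.mem_range.1 hk)
  · exact mul_nonneg (div_nonneg (le_min hr.le h.le) h.le) (Real.rpow_nonneg h.le _)
  · set c := min 1 (max 0 (s - k))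
    have hc0 : 0 ≤ c := le_min zero_le_one (le_max_left _ _)
    have hc1 : c ≤ 1 := min_le_left _ _
    rw [← le_div_iff₀ (Real.rpow_pos_of_pos h _), ← Real.div_rpow hr.le h.le]
    rcases le_total r (singVal A k) with h1 | h1
    · rw [min_eq_left h1]
      exact Real.self_le_rpow_of_le_one (div_nonneg hr.le h.le) ((div_le_one h).2 h1) hc1
    · rw [min_eq_right h1, div_self h.ne']
      exact Real.one_le_rpow ((one_le_div h).2 h1) hc0

/-- The bound `truncRatio_mul_svf_le` is sharp when r is comparable to α_{⌊s⌋+1}. Before that index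
the exponent is 1 and the factor is exactly r; at it r/α ≥ 1/2; after it the exponent is 0 and α ≤
2r. Each factor loses at most 2. -/
theorem rpow_le_truncRatio_mul_svf (hA : A.det ≠ 0) {r : ℝ} (hr : 0 < r) {s : ℝ} (hs : 0 ≤ s)
    (hsd : s < d) (h1 : r ≤ singVal A ⌊s⌋₊) (h2 : singVal A ⌊s⌋₊ ≤ 2 * r) :
    (1 / 2) ^ d * r ^ s ≤ truncRatio A r * svf s A := by
  rw [svf_eq_prod hA hs hsd, ← prod_rpow_eq hr hs hsd, truncRatio, ← Finset.prod_mul_distrib]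
  have : (1 / 2 : ℝ) ^ d = ∏ _i ∈ Finset.range d, (1 / 2 : ℝ) := by simp
  rw [this, ← Finset.prod_mul_distrib]
  have hf1 := Nat.floor_le hs
  have hf2 := Nat.lt_floor_add_one s
  have hanti : Antitone (singVal A) := LinearMap.singularValues_antitone _
  refine Finset.prod_le_prod (fun k hk => by positivity) fun k hk => ?_
  have h := singVal_pos hA (Finset.mem_range.1 hk)
  rcases lt_trichotomy k ⌊s⌋₊ with hk' | rfl | hk'
  · have : (k : ℝ) + 1 ≤ ⌊s⌋₊ := by exact_mod_cast hk'
    rw [max_eq_right (by linarith), min_eq_left (by linarith), Real.rpow_one, Real.rpow_one,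
      min_eq_left (h1.trans (hanti hk'.le)), div_mul_cancel₀ _ h.ne']
    linarith
  · rw [min_eq_left h1]
    refine mul_le_mul ?_ (Real.rpow_le_rpow hr.le h1 (le_min zero_le_one (le_max_left _ _)))
      (Real.rpow_nonneg hr.le _) (div_nonneg hr.le h.le)
    rw [le_div_iff₀ h]
    linarith
  · have : (⌊s⌋₊ : ℝ) + 1 ≤ k := by exact_mod_cast hk'
    rw [max_eq_left (by linarith), min_eq_right zero_le_one, Real.rpow_zero, Real.rpow_zero,
      mul_one, mul_one, le_div_iff₀ h]
    exact le_min (by linarith [(hanti hk'.le).trans h2]) (by linarith)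

/-- Only few cells of side `r` are needed to cover the image of a ball under `A`. -/
theorem exists_cells (hd : 0 < d) (hA : A.det ≠ 0) {R r : ℝ} (hR : 0 ≤ R) (hr : 0 < r) :
    ∃ (F : Finset (Fin d → ℤ)) (q : Euc d → Fin d → ℤ),
      (∀ u, ‖u‖ ≤ R → q u ∈ F) ∧
      (∀ u u', q u = q u' → ‖Matrix.toEuclideanCLM (n := Fin d) (𝕜 := ℝ) A (u - u')‖ ≤ r) ∧
      (F.card : ℝ) * truncRatio A r ≤ (2 * R * √d + 2) ^ d := by
  obtain ⟨v, hv⟩ := exists_orthonormalBasis_norm_sq_eq A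
  have hd' : (0 : ℝ) < √d := Real.sqrt_pos.2 (by exact_mod_cast hd)
  have hpos : ∀ k : Fin d, 0 < singVal A k := fun k => singVal_pos hA k.2
  -- Cells have side r/(α_k√d) along the k-th singular direction, so their images have sides r/√d
  -- and diameter at most r.
  let e : Fin d → ℝ := fun k => singVal A k * √d / r
  have he : ∀ k, 0 < e k := fun k => div_pos (mul_pos (hpos k) hd') hr
  refine ⟨Fintype.piFinset fun k => Finset.Icc ⌊-(R * e k)⌋ ⌊R * e k⌋,
    fun u k => ⌊v.repr u k * e k⌋, ?_, ?_, ?_⟩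
  · intro u hu
    rw [Fintype.mem_piFinset]
    intro k
    have h1 : |v.repr u k| ≤ R := by
      have := PiLp.norm_apply_le (v.repr u) k
      rw [LinearIsometryEquiv.norm_map, Real.norm_eq_abs] at this
      exact this.trans hu
    rw [abs_le] at h1
    rw [Finset.mem_Icc]
    constructor
    · apply Int.floor_mono
      nlinarith [he k]
    · apply Int.floor_mono
      nlinarith [he k]
  · intro u u' h
    have h1 : ∀ k : Fin d, (singVal A k * v.repr (u - u') k) ^ 2 ≤ r ^ 2 / d := by
      intro k
      have h2 := Int.abs_sub_lt_one_of_floor_eq_floor (congrFun h k)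
      rw [← sub_mul, abs_mul, abs_of_pos (he k)] at h2
      have h3 : |singVal A k * v.repr (u - u') k| ≤ r / √d := by
        rw [abs_mul, abs_of_pos (hpos k), le_div_iff₀ hd']
        simp only [e] at h2
        rw [mul_div_assoc', div_lt_one hr] at h2
        simp only [map_sub, PiLp.sub_apply]
        linarith
      calc _ = |singVal A k * v.repr (u - u') k| ^ 2 := (sq_abs _).symm
        _ ≤ (r / √d) ^ 2 := by gcongr
        _ = r ^ 2 / d := by rw [div_pow, Real.sq_sqrt (Nat.cast_nonneg d)]
    refine le_of_sq_le_sq ?_ hr.le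
    rw [hv]
    calc _ ≤ ∑ _k : Fin d, r ^ 2 / d := Finset.sum_le_sum fun k _ => h1 k
      _ = r ^ 2 := by
        have : (d : ℝ) ≠ 0 := by exact_mod_cast hd.ne'
        simp
        field_simp
  · rw [Fintype.card_piFinset, truncRatio, ← Fin.prod_univ_eq_prod_range (fun k =>
      min r (singVal A k) / singVal A k)]
    push_cast
    rw [← Finset.prod_mul_distrib]
    calc _ ≤ ∏ _k : Fin d, (2 * R * √d + 2) := by
          refine Finset.prod_le_prod (fun k _ => ?_) fun k _ => ?_
          · exact mul_nonneg (Nat.cast_nonneg _)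
              (div_nonneg (le_min hr.le (hpos k).le) (hpos k).le)
          · have hle : ⌊-(R * e k)⌋ ≤ ⌊R * e k⌋ + 1 := by
              have : ⌊-(R * e k)⌋ ≤ ⌊R * e k⌋ := Int.floor_mono (by nlinarith [he k])
              omega
            have hcard : ((Finset.Icc ⌊-(R * e k)⌋ ⌊R * e k⌋).card : ℝ) ≤ 2 * R * e k + 2 := by
              rw [Int.card_Icc]
              have h3 : (((⌊R * e k⌋ + 1 - ⌊-(R * e k)⌋).toNat : ℤ) : ℝ) =
                  ((⌊R * e k⌋ + 1 - ⌊-(R * e k)⌋ : ℤ) : ℝ) := by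
                rw [Int.toNat_of_nonneg (by omega)]
              rw [Int.cast_natCast] at h3
              rw [h3]
              push_cast
              linarith [Int.floor_le (R * e k), Int.lt_floor_add_one (-(R * e k))]
            have hm0 : 0 ≤ min r (singVal A k) / singVal A k :=
              div_nonneg (le_min hr.le (hpos k).le) (hpos k).le
            have hm1 : min r (singVal A k) / singVal A k ≤ 1 :=
              div_le_one_of_le₀ (min_le_right _ _) (hpos k).le
            -- Direction k needs at most 2R e_k + 2 cells. Multiplying by min(r, α_k)/α_k ≤ 1 leaves
            -- at most 2R√d + 2, because the α_k cancels.
            have hm2 : e k * (min r (singVal A k) / singVal A k) ≤ √d := by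
              have : min r (singVal A k) / r ≤ 1 := div_le_one_of_le₀ (min_le_left _ _) hr.le
              calc _ = √d * (min r (singVal A k) / r) := by
                    simp only [e]
                    have := (hpos k).ne'
                    field_simp
                _ ≤ √d * 1 := by gcongr
                _ = √d := mul_one _
            calc _ ≤ (2 * R * e k + 2) * (min r (singVal A k) / singVal A k) := by gcongr
              _ = 2 * R * (e k * (min r (singVal A k) / singVal A k)) +
                  2 * (min r (singVal A k) / singVal A k) := by ring
              _ ≤ 2 * R * √d + 2 * 1 := by gcongr
              _ = _ := by ring
      _ = _ := by simp

/-- The volume of the part of the ellipsoid `{u : ‖A u‖ ≤ r}` inside a ball. -/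
theorem volume_ellipsoid_le (hA : A.det ≠ 0) {R r : ℝ} (hR : 1 ≤ R) (hr : 0 < r) :
    volume {u : Euc d | ‖u‖ ≤ R ∧ ‖Matrix.toEuclideanCLM (n := Fin d) (𝕜 := ℝ) A u‖ ≤ r} ≤
      ENNReal.ofReal ((2 * R) ^ d * truncRatio A r) := by
  obtain ⟨v, hv⟩ := exists_orthonormalBasis_norm_sq_eq A
  have hpos : ∀ k : Fin d, 0 < singVal A k := fun k => singVal_pos hA k.2
  -- Half-widths of a box containing the set: |u_k| ≤ R from the ball and |u_k| ≤ r/α_k ≤ R r/α_k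
  -- from the ellipsoid, using R ≥ 1.
  let c : Fin d → ℝ := fun k => R * (min r (singVal A k) / singVal A k)
  let box : Set (Fin d → ℝ) := Set.univ.pi fun k => Set.Icc (-c k) (c k)
  have hmp := (EuclideanSpace.volume_preserving_symm_measurableEquiv_toLp (Fin d)).comp
    v.measurePreserving_repr
  calc _ ≤ volume ((⇑(MeasurableEquiv.toLp 2 (Fin d → ℝ)).symm ∘ ⇑v.repr) ⁻¹' box) := by
        refine measure_mono ?_
        rintro u ⟨h1, h2⟩
        refine Set.mem_univ_pi.2 fun k => ?_
        show -c k ≤ v.repr u k ∧ v.repr u k ≤ c k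
        rw [← abs_le]
        have h3 : |v.repr u k| ≤ R := by
          have := PiLp.norm_apply_le (v.repr u) k
          rw [LinearIsometryEquiv.norm_map, Real.norm_eq_abs] at this
          exact this.trans h1
        have h4 : singVal A k * |v.repr u k| ≤ r := by
          refine le_of_sq_le_sq ?_ hr.le
          calc (singVal A k * |v.repr u k|) ^ 2 = (singVal A k * v.repr u k) ^ 2 := by
                rw [mul_pow, mul_pow, sq_abs]
            _ ≤ _ := Finset.single_le_sum (f := fun k : Fin d => (singVal A k * v.repr u k) ^ 2)
                (fun _ _ => sq_nonneg _) (Finset.mem_univ k)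
            _ ≤ r ^ 2 := by
              rw [← hv]
              gcongr
        simp only [c]
        rw [mul_div_assoc', le_div_iff₀ (hpos k)]
        rcases le_total r (singVal A k) with h | h
        · rw [min_eq_left h]
          nlinarith
        · rw [min_eq_right h]
          exact mul_le_mul_of_nonneg_right h3 (hpos k).le
    _ = volume box := hmp.measure_preimage
        (MeasurableSet.univ_pi fun _ => measurableSet_Icc).nullMeasurableSet
    _ = ENNReal.ofReal ((2 * R) ^ d * truncRatio A r) := by
        rw [volume_pi_pi]
        simp only [Real.volume_Icc]
        rw [← ENNReal.ofReal_prod_of_nonneg]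
        · congr 1
          rw [truncRatio, ← Fin.prod_univ_eq_prod_range (fun k =>
            min r (singVal A k) / singVal A k), ← Fin.prod_const, ← Finset.prod_mul_distrib]
          refine Finset.prod_congr rfl fun k _ => ?_
          simp only [c]
          ring
        · intro k _
          have : 0 ≤ c k := mul_nonneg (by linarith)
            (div_nonneg (le_min hr.le (hpos k).le) (hpos k).le)
          linarith

end SingularValues

/-- The operator on `ℝ^d` given by a matrix. -/
local notation "toOp" => Matrix.toEuclideanCLM (n := Fin _) (𝕜 := ℝ)

theorem exists_uniform_bound {m : ℕ} {f : Fin m → ℝ} {c : ℝ} (hc : 0 < c) (h0 : ∀ i, 0 ≤ f i)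
    (h : ∀ i, f i < c) : ∃ ρ, 0 ≤ ρ ∧ ρ < c ∧ ∀ i, f i ≤ ρ := by
  let g : Fin m → NNReal := fun i => ⟨f i, h0 i⟩
  refine ⟨(Finset.univ.sup g : NNReal), NNReal.coe_nonneg _, ?_, fun i => ?_⟩
  · have : Finset.univ.sup g < ⟨c, hc.le⟩ :=
      (Finset.sup_lt_iff (show (⊥ : NNReal) < ⟨c, hc.le⟩ from hc)).2 fun i _ => h i
    exact this
  · exact Finset.le_sup (f := g) (Finset.mem_univ i)

/-! ### The coding map: series, self-affinity, measurability -/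

section CodingMap

variable {m d : ℕ} {T : Fin m → Matrix (Fin d) (Fin d) ℝ} {ρ : ℝ}

/-- The sequence `x` without its first `n` symbols. -/
def shiftBy (n : ℕ) (x : Shift m) : Shift m := fun k => x (n + k)

theorem opNorm_prefixProd_le (h0 : 0 ≤ ρ) (hT : ∀ i, opNorm (T i) ≤ ρ) (x : Shift m) (n : ℕ) :
    opNorm (prefixProd T x n) ≤ ρ ^ n := by
  induction n with
  | zero =>
    simp only [prefixProd, opNorm, map_one, pow_zero]
    exact ContinuousLinearMap.norm_id_le
  | succ n ih =>
    rw [prefixProd, pow_succ]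
    exact (opNorm_mul_le _ _).trans (mul_le_mul ih (hT _) (norm_nonneg _) (pow_nonneg h0 n))

theorem det_prefixProd_ne_zero (hT : ∀ i, (T i).det ≠ 0) (x : Shift m) (n : ℕ) :
    (prefixProd T x n).det ≠ 0 := by
  induction n with
  | zero => simp [prefixProd]
  | succ n ih =>
    rw [prefixProd, Matrix.det_mul]
    exact mul_ne_zero ih (hT _)

theorem prefixProd_congr {x y : Shift m} {n : ℕ} (h : ∀ i < n, y i = x i) :
    prefixProd T y n = prefixProd T x n := by
  induction n with
  | zero => rfl
  | succ n ih =>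
    rw [prefixProd, prefixProd, ih fun i hi => h i (hi.trans n.lt_succ_self), h n n.lt_succ_self]

theorem prefixProd_add (x : Shift m) (n k : ℕ) :
    prefixProd T x (n + k) = prefixProd T x n * prefixProd T (shiftBy n x) k := by
  induction k with
  | zero => simp [prefixProd]
  | succ k ih => rw [← add_assoc, prefixProd, ih, prefixProd, mul_assoc]; rfl

theorem toOp_mul_apply (A B : Matrix (Fin d) (Fin d) ℝ) (v : Euc d) :
    toOp (A * B) v = toOp A (toOp B v) := by
  rw [map_mul]
  rfl

theorem norm_toOp_prefixProd_apply_le (h0 : 0 ≤ ρ) (hT : ∀ i, opNorm (T i) ≤ ρ) (x : Shift m)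
    (n : ℕ) (v : Euc d) : ‖toOp (prefixProd T x n) v‖ ≤ ρ ^ n * ‖v‖ :=
  (ContinuousLinearMap.le_opNorm _ _).trans
    (mul_le_mul_of_nonneg_right (opNorm_prefixProd_le h0 hT x n) (norm_nonneg _))

theorem ifsComp_apply (a : Fin m → Euc d) (x : Shift m) (n : ℕ) (v : Euc d) :
    ifsComp T a x n v = toOp (prefixProd T x n) v +
      ∑ k ∈ Finset.range n, toOp (prefixProd T x k) (a (x k)) := by
  induction n generalizing v with
  | zero => simp [ifsComp, prefixProd]
  | succ n ih =>
    rw [ifsComp, Function.comp_apply, ih, ifsMap, map_add, ← toOp_mul_apply,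
      Finset.sum_range_succ, prefixProd]
    abel

theorem summable_codingMap (h0 : 0 ≤ ρ) (h1 : ρ < 1) (hT : ∀ i, opNorm (T i) ≤ ρ)
    (a : Fin m → Euc d) (x : Shift m) :
    Summable fun k => toOp (prefixProd T x k) (a (x k)) := by
  refine Summable.of_norm_bounded ((summable_geometric_of_lt_one h0 h1).mul_right ‖a‖) fun k => ?_
  exact (norm_toOp_prefixProd_apply_le h0 hT x k _).trans
    (mul_le_mul_of_nonneg_left (norm_le_pi_norm a _) (pow_nonneg h0 k))

theorem tendsto_codingMap (h0 : 0 ≤ ρ) (h1 : ρ < 1) (hT : ∀ i, opNorm (T i) ≤ ρ)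
    (a : Fin m → Euc d) (x : Shift m) :
    Tendsto (fun n => ifsComp T a x n 0) atTop
      (𝓝 (∑' k, toOp (prefixProd T x k) (a (x k)))) := by
  simp only [ifsComp_apply, map_zero, zero_add]
  exact (summable_codingMap h0 h1 hT a x).hasSum.tendsto_sum_nat

theorem codingMap_eq_tsum (h0 : 0 ≤ ρ) (h1 : ρ < 1) (hT : ∀ i, opNorm (T i) ≤ ρ)
    (a : Fin m → Euc d) (x : Shift m) :
    codingMap T a x = ∑' k, toOp (prefixProd T x k) (a (x k)) :=
  (tendsto_codingMap h0 h1 hT a x).limUnder_eq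

theorem norm_codingMap_le (h0 : 0 ≤ ρ) (h1 : ρ < 1) (hT : ∀ i, opNorm (T i) ≤ ρ)
    {a : Fin m → Euc d} {M : ℝ} (ha : ∀ i, ‖a i‖ ≤ M) (x : Shift m) :
    ‖codingMap T a x‖ ≤ (1 - ρ)⁻¹ * M := by
  rw [codingMap_eq_tsum h0 h1 hT]
  refine tsum_of_norm_bounded ((hasSum_geometric_of_lt_one h0 h1).mul_right M) fun k => ?_
  exact (norm_toOp_prefixProd_apply_le h0 hT x k _).trans
    (mul_le_mul_of_nonneg_left (ha _) (pow_nonneg h0 k))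

theorem codingMap_eq_add (h0 : 0 ≤ ρ) (h1 : ρ < 1) (hT : ∀ i, opNorm (T i) ≤ ρ)
    (a : Fin m → Euc d) (x : Shift m) (n : ℕ) :
    codingMap T a x = ∑ k ∈ Finset.range n, toOp (prefixProd T x k) (a (x k)) +
      toOp (prefixProd T x n) (codingMap T a (shiftBy n x)) := by
  rw [codingMap_eq_tsum h0 h1 hT, codingMap_eq_tsum h0 h1 hT,
    ← (summable_codingMap h0 h1 hT a x).sum_add_tsum_nat_add n, ContinuousLinearMap.map_tsum _
      (summable_codingMap h0 h1 hT a _)]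
  congr 2
  funext k
  rw [← toOp_mul_apply, ← prefixProd_add, add_comm k n]
  rfl

/-- Both codes apply the same affine map, determined by the common prefix, to the codes of their
tails; the translation part cancels. -/
theorem codingMap_sub (h0 : 0 ≤ ρ) (h1 : ρ < 1) (hT : ∀ i, opNorm (T i) ≤ ρ)
    (a : Fin m → Euc d) {x y : Shift m} {n : ℕ} (h : ∀ i < n, y i = x i) :
    codingMap T a x - codingMap T a y = toOp (prefixProd T x n)
      (codingMap T a (shiftBy n x) - codingMap T a (shiftBy n y)) := by
  rw [codingMap_eq_add h0 h1 hT a x n, codingMap_eq_add h0 h1 hT a y n, prefixProd_congr h, map_sub]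
  have : ∑ k ∈ Finset.range n, toOp (prefixProd T y k) (a (y k)) =
      ∑ k ∈ Finset.range n, toOp (prefixProd T x k) (a (x k)) := by
    refine Finset.sum_congr rfl fun k hk => ?_
    rw [h k (Finset.mem_range.1 hk), prefixProd_congr fun i hi => h i (hi.trans (Finset.mem_range.1 hk))]
  rw [this]
  abel

theorem continuous_symbol (n : ℕ) :
    Continuous fun p : (Fin m → Euc d) × Shift m => p.1 (p.2 n) := by
  have h : (fun p : (Fin m → Euc d) × Shift m => p.1 (p.2 n)) =
      (fun q : (Fin m → Euc d) × Fin m => q.1 q.2) ∘ fun p => (p.1, p.2 n) := rfl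
  rw [h]
  refine Continuous.comp ?_ (by fun_prop)
  exact continuous_prod_of_discrete_right.2 fun i => continuous_apply i

theorem continuous_prefixProd (n : ℕ) : Continuous fun x : Shift m => prefixProd T x n := by
  induction n with
  | zero => exact continuous_const
  | succ n ih =>
    exact ih.mul (continuous_of_discreteTopology.comp (continuous_apply n))

/-- Joint measurability in translation and sequence is what the Fubini arguments need; it holds as a
pointwise limit of continuous maps. -/
theorem measurable_codingMap_uncurry (h0 : 0 ≤ ρ) (h1 : ρ < 1) (hT : ∀ i, opNorm (T i) ≤ ρ) :
    Measurable fun p : (Fin m → Euc d) × Shift m => codingMap T p.1 p.2 := by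
  refine measurable_of_tendsto_metrizable
    (f := fun n (p : (Fin m → Euc d) × Shift m) => ifsComp T p.1 p.2 n 0) (fun n => ?_)
    (tendsto_pi_nhds.2 fun p => ?_)
  · simp only [ifsComp_apply, map_zero, zero_add]
    refine Continuous.measurable (continuous_finsetSum _ fun k _ => ?_)
    have h2 : Continuous fun A : Matrix (Fin d) (Fin d) ℝ => (toOp A : Euc d →L[ℝ] Euc d) :=
      LinearMap.continuous_of_finiteDimensional
        (Matrix.toEuclideanCLM (n := Fin d) (𝕜 := ℝ)).toAlgEquiv.toLinearMap
    exact (h2.comp ((continuous_prefixProd k).comp continuous_snd)).clm_apply (continuous_symbol k)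
  · rw [codingMap_eq_tsum h0 h1 hT]
    exact tendsto_codingMap h0 h1 hT _ _

theorem measurable_codingMap (h0 : 0 ≤ ρ) (h1 : ρ < 1) (hT : ∀ i, opNorm (T i) ≤ ρ)
    (a : Fin m → Euc d) : Measurable (codingMap T a) :=
  (measurable_codingMap_uncurry h0 h1 hT).comp measurable_prodMk_left

/-- The function factors through the first n letters, hence through a finite discrete set, so F may
be arbitrary. -/
theorem measurable_of_prefixProd {β : Type*} [MeasurableSpace β]
    (F : Matrix (Fin d) (Fin d) ℝ → β) (n : ℕ) :
    Measurable fun x : Shift m => F (prefixProd T x n) := by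
  let q : Shift m → Fin n → Fin m := fun x i => x i
  have hq : Measurable q := measurable_pi_lambda _ fun i => measurable_pi_apply _
  rcases isEmpty_or_nonempty (Shift m) with h | ⟨⟨x₀⟩⟩
  · exact measurable_of_empty _
  -- A word is completed to a sequence with the letters of a fixed x₀; the prefix product does not
  -- see them.
  let e : (Fin n → Fin m) → Shift m := fun w k => if h : k < n then w ⟨k, h⟩ else x₀ k
  have : (fun x : Shift m => F (prefixProd T x n)) = (fun w => F (prefixProd T (e w) n)) ∘ q := by
    funext x
    simp only [Function.comp_apply]
    rw [prefixProd_congr (x := x) (y := e (q x)) fun i hi => by simp [e, q, hi]]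
  rw [this]
  exact (measurable_of_countable _).comp hq

theorem measurableSet_cylinder (x : Shift m) (n : ℕ) : MeasurableSet (PiNat.cylinder x n) := by
  rw [PiNat.cylinder_eq_pi]
  exact MeasurableSet.pi (Finset.countable_toSet _) fun _ _ => MeasurableSet.of_discrete

end CodingMap

/-! ### The kernel Z and the function G -/

section Kernel

variable {m d : ℕ} {T : Fin m → Matrix (Fin d) (Fin d) ℝ} {ρ : ℝ} {μ : Measure (Shift m)}

theorem Zfun_of_ne {x y : Shift m} (h : x ≠ y) (r : ℝ) :
    Zfun T x y r = truncRatio (prefixProd T x (PiNat.firstDiff x y)) r := if_neg h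

theorem Zfun_self (x : Shift m) (r : ℝ) : Zfun T x x r = 1 := if_pos rfl

theorem Zfun_le_one (hT : ∀ i, (T i).det ≠ 0) (x y : Shift m) {r : ℝ} (hr : 0 ≤ r) :
    Zfun T x y r ≤ 1 := by
  rcases eq_or_ne x y with rfl | h
  · rw [Zfun_self]
  · rw [Zfun_of_ne h]
    exact truncRatio_le_one (det_prefixProd_ne_zero hT _ _) hr

theorem Zfun_mono (hT : ∀ i, (T i).det ≠ 0) (x y : Shift m) {r s : ℝ} (hr : 0 ≤ r)
    (hrs : r ≤ s) : Zfun T x y r ≤ Zfun T x y s := by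
  rcases eq_or_ne x y with rfl | h
  · rw [Zfun_self, Zfun_self]
  · rw [Zfun_of_ne h, Zfun_of_ne h]
    exact truncRatio_mono (det_prefixProd_ne_zero hT _ _) hr hrs

theorem pow_le_Zfun (hT : ∀ i, (T i).det ≠ 0) (hT1 : ∀ i, opNorm (T i) ≤ 1)
    (x y : Shift m) {r : ℝ} (hr : 0 ≤ r) (hr1 : r ≤ 1) : r ^ d ≤ Zfun T x y r := by
  rcases eq_or_ne x y with rfl | h
  · rw [Zfun_self]
    exact pow_le_one₀ hr hr1
  · rw [Zfun_of_ne h]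
    refine pow_le_truncRatio (det_prefixProd_ne_zero hT _ _) ?_ hr hr1
    simpa using opNorm_prefixProd_le zero_le_one hT1 x (PiNat.firstDiff x y)

theorem measurable_firstDiff :
    Measurable fun p : Shift m × Shift m => PiNat.firstDiff p.1 p.2 := by
  have hle : ∀ n, MeasurableSet {p : Shift m × Shift m | ∀ i < n, p.1 i = p.2 i} := by
    intro n
    have : {p : Shift m × Shift m | ∀ i < n, p.1 i = p.2 i} =
        ⋂ i, ⋂ (_ : i < n), {p | p.1 i = p.2 i} := by
      ext p
      simp
    rw [this]
    exact MeasurableSet.iInter fun i => MeasurableSet.iInter fun _ =>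
      measurableSet_eq_fun (by fun_prop) (by fun_prop)
  have hdiag : MeasurableSet {p : Shift m × Shift m | p.1 = p.2} :=
    measurableSet_eq_fun measurable_fst measurable_snd
  refine measurable_of_Ici fun n => ?_
  -- `PiNat.firstDiff` takes the default value 0 on the diagonal, so the diagonal belongs to the
  -- superlevel set only for n = 0.
  rcases Nat.eq_zero_or_pos n with rfl | hn
  · have : (fun p : Shift m × Shift m => PiNat.firstDiff p.1 p.2) ⁻¹' Set.Ici 0 = Set.univ := by
      ext p
      simp
    rw [this]
    exact MeasurableSet.univ
  · convert (hle n).diff hdiag using 1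
    ext p
    simp only [Set.mem_preimage, Set.mem_Ici, Set.mem_sdiff, Set.mem_ofPred_eq]
    constructor
    · intro h
      have hne : p.1 ≠ p.2 := by
        intro he
        rw [PiNat.firstDiff_def, dif_neg (not_not.2 he)] at h
        omega
      exact ⟨fun i hi => PiNat.apply_eq_of_lt_firstDiff (hi.trans_le h), hne⟩
    · rintro ⟨h, hne⟩
      exact (PiNat.mem_cylinder_iff_le_firstDiff hne n).1 h

theorem measurable_truncRatio_prefixProd (r : ℝ) :
    Measurable fun q : Shift m × ℕ => truncRatio (prefixProd T q.1 q.2) r :=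
  measurable_from_prod_countable_left fun n => measurable_of_prefixProd (fun A => truncRatio A r) n

theorem measurable_Zfun (r : ℝ) : Measurable fun p : Shift m × Shift m => Zfun T p.1 p.2 r := by
  classical
  have h : (fun p : Shift m × Shift m => Zfun T p.1 p.2 r) =
      {p : Shift m × Shift m | p.1 = p.2}.piecewise (fun _ => 1)
        fun p => truncRatio (prefixProd T p.1 (PiNat.firstDiff p.1 p.2)) r := by
    funext p
    by_cases hp : p.1 = p.2
    · rw [Set.piecewise_eq_of_mem _ _ _ (show p ∈ {p : Shift m × Shift m | p.1 = p.2} from hp),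
        Zfun, if_pos hp]
    · rw [Set.piecewise_eq_of_notMem _ _ _ (show p ∉ {p : Shift m × Shift m | p.1 = p.2} from hp),
        Zfun_of_ne hp]
  have h1 : Measurable fun p : Shift m × Shift m => (p.1, PiNat.firstDiff p.1 p.2) :=
    measurable_fst.prodMk measurable_firstDiff
  have h2 := (measurable_truncRatio_prefixProd (T := T) r).comp h1
  rw [h]
  exact Measurable.piecewise (measurableSet_eq_fun measurable_fst measurable_snd) measurable_const h2

theorem measurable_Gfun [SFinite μ] (r : ℝ) : Measurable fun x => Gfun T μ x r :=
  Measurable.lintegral_prod_right (measurable_Zfun r).ennreal_ofReal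

theorem Gfun_monotoneOn (hT : ∀ i, (T i).det ≠ 0) (x : Shift m) :
    MonotoneOn (Gfun T μ x) (Set.Ioi 0) := fun _ hr _ _ hrs =>
  lintegral_mono fun y => ENNReal.ofReal_le_ofReal (Zfun_mono hT x y (le_of_lt hr) hrs)

/-- If y leaves x at some n < N, then Z_{x∧y} is the n-th ratio. All other y lie in [x|N], where Z ≤
1 and the N-th ratio equals 1, because ‖T_{x|N}‖ ≤ ρ^N ≤ r. -/
theorem Gfun_le_sum (h0 : 0 ≤ ρ) (hT : ∀ i, (T i).det ≠ 0) (hTρ : ∀ i, opNorm (T i) ≤ ρ)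
    (x : Shift m) {r : ℝ} (hr : 0 ≤ r) {N : ℕ} (hN : ρ ^ N ≤ r) :
    Gfun T μ x r ≤ ∑ n ∈ Finset.range (N + 1),
      ENNReal.ofReal (truncRatio (prefixProd T x n) r) * μ (PiNat.cylinder x n) := by
  have hN1 : truncRatio (prefixProd T x N) r = 1 :=
    truncRatio_eq_one (det_prefixProd_ne_zero hT _ _)
      ((opNorm_prefixProd_le h0 hTρ x N).trans hN)
  have key : ∀ y, ENNReal.ofReal (Zfun T x y r) ≤ ∑ n ∈ Finset.range (N + 1),
      (PiNat.cylinder x n).indicator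
        (fun _ => ENNReal.ofReal (truncRatio (prefixProd T x n) r)) y := by
    intro y
    have hlast : y ∈ PiNat.cylinder x N → ENNReal.ofReal (Zfun T x y r) ≤
        ∑ n ∈ Finset.range (N + 1), (PiNat.cylinder x n).indicator
          (fun _ => ENNReal.ofReal (truncRatio (prefixProd T x n) r)) y := by
      intro hy
      refine le_trans ?_ (Finset.single_le_sum (fun _ _ => zero_le)
        (Finset.mem_range.2 N.lt_succ_self))
      rw [Set.indicator_of_mem hy, hN1]
      exact ENNReal.ofReal_le_ofReal (Zfun_le_one hT x y hr)
    rcases eq_or_ne x y with rfl | hne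
    · exact hlast (PiNat.self_mem_cylinder x N)
    · rcases le_or_gt N (PiNat.firstDiff x y) with h | h
      · exact hlast ((PiNat.mem_cylinder_comm _ _ _).1
          ((PiNat.mem_cylinder_iff_le_firstDiff hne N).2 h))
      · refine le_trans ?_ (Finset.single_le_sum (fun _ _ => zero_le)
          (Finset.mem_range.2 (h.trans N.lt_succ_self)))
        rw [Set.indicator_of_mem ((PiNat.mem_cylinder_comm _ _ _).1
          (PiNat.mem_cylinder_firstDiff x y)), Zfun_of_ne hne]
  refine (lintegral_mono key).trans (le_of_eq ?_)
  rw [lintegral_finsetSum _ fun n _ => measurable_const.indicator (measurableSet_cylinder x n)]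
  refine Finset.sum_congr rfl fun n _ => ?_
  rw [lintegral_indicator_const (measurableSet_cylinder x n)]

variable [IsProbabilityMeasure μ]

theorem Gfun_le_one (hT : ∀ i, (T i).det ≠ 0) (x : Shift m) {r : ℝ} (hr : 0 ≤ r) :
    Gfun T μ x r ≤ 1 := by
  refine (lintegral_mono fun y => ENNReal.ofReal_le_one.2 (Zfun_le_one hT x y hr)).trans ?_
  simp

theorem Gfun_pos (hT : ∀ i, (T i).det ≠ 0) (hT1 : ∀ i, opNorm (T i) ≤ 1) (x : Shift m) {r : ℝ}
    (hr : 0 < r) (hr1 : r ≤ 1) : Gfun T μ x r ≠ 0 := by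
  have h : ENNReal.ofReal (r ^ d) ≤ Gfun T μ x r := by
    calc ENNReal.ofReal (r ^ d) = ∫⁻ _, ENNReal.ofReal (r ^ d) ∂μ := by simp
      _ ≤ _ := lintegral_mono fun y => ENNReal.ofReal_le_ofReal (pow_le_Zfun hT hT1 x y hr.le hr1)
  exact (lt_of_lt_of_le (ENNReal.ofReal_pos.2 (pow_pos hr d)) h).ne'

theorem Dloc_eq (hT : ∀ i, (T i).det ≠ 0) (x : Shift m) :
    Dloc T μ x = limsup (dyadicRatio fun j => Gfun T μ x (dyad j)) atTop :=
  limsup_log_div_log_eq (Gfun_monotoneOn hT x) fun _ hr => Gfun_le_one hT x hr.le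

end Kernel

/-! ### Upper bounds for the local dimensions -/

theorem measure_le_mul_of_fiber {X ι : Type*} [MeasurableSpace X] [Fintype ι] [MeasurableSpace ι]
    [MeasurableSingletonClass ι] {μ : Measure X} {q : X → ι} (hq : Measurable q) {B : Set X}
    {c : ℝ≥0∞} (h : ∀ x, μ (B ∩ q ⁻¹' {q x}) ≤ c * μ (q ⁻¹' {q x})) :
    μ B ≤ c * μ Set.univ := by
  classical
  have h' : ∀ i, μ (B ∩ q ⁻¹' {i}) ≤ c * μ (q ⁻¹' {i}) := by
    intro i
    by_cases hi : ∃ x, q x = i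
    · obtain ⟨x, rfl⟩ := hi
      exact h x
    · have : q ⁻¹' {i} = ∅ := Set.eq_empty_of_forall_notMem fun x hx => hi ⟨x, hx⟩
      simp [this]
  calc μ B ≤ μ (⋃ i, B ∩ q ⁻¹' {i}) := measure_mono fun x hx =>
        Set.mem_iUnion.2 ⟨q x, hx, rfl⟩
    _ ≤ ∑ i, μ (B ∩ q ⁻¹' {i}) := measure_iUnion_fintype_le _ _
    _ ≤ ∑ i, c * μ (q ⁻¹' {i}) := Finset.sum_le_sum fun i _ => h' i
    _ = c * μ Set.univ := by
      rw [← Finset.mul_sum, sum_measure_preimage_singleton _ fun i _ =>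
        hq (measurableSet_singleton i)]
      simp

theorem measure_le_card_mul {X ι : Type*} [MeasurableSpace X] {μ : Measure X} {F : Finset ι}
    {q : X → ι} {B : Set X} {c : ℝ≥0∞} (hF : ∀ x ∈ B, q x ∈ F)
    (h : ∀ x ∈ B, μ (B ∩ q ⁻¹' {q x}) ≤ c) : μ B ≤ F.card * c := by
  calc μ B ≤ μ (⋃ i ∈ F, B ∩ q ⁻¹' {i}) := measure_mono fun x hx =>
        Set.mem_iUnion₂.2 ⟨q x, hF x hx, hx, rfl⟩
    _ ≤ ∑ i ∈ F, μ (B ∩ q ⁻¹' {i}) := measure_biUnion_finset_le _ _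
    _ ≤ ∑ _i ∈ F, c := by
      refine Finset.sum_le_sum fun i _ => ?_
      rcases (B ∩ q ⁻¹' {i}).eq_empty_or_nonempty with he | ⟨x, hx, rfl⟩
      · simp [he]
      · exact h x hx
    _ = F.card * c := by simp

section Upper

variable {m d : ℕ} {T : Fin m → Matrix (Fin d) (Fin d) ℝ} {ρ : ℝ} {μ : Measure (Shift m)}

theorem cylinder_eq_preimage (x : Shift m) (n : ℕ) :
    PiNat.cylinder x n = (fun (y : Shift m) (i : Fin n) => y i) ⁻¹' {fun i : Fin n => x i} := by
  ext y
  simp only [PiNat.mem_cylinder_iff, Set.mem_preimage, Set.mem_singleton_iff, funext_iff]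
  exact ⟨fun h i => h i i.2, fun h i hi => h ⟨i, hi⟩⟩

theorem isProbabilityMeasure_projMeasure [IsProbabilityMeasure μ] {a : Fin m → Euc d}
    (h : Measurable (codingMap T a)) : IsProbabilityMeasure (projMeasure T a μ) :=
  Measure.isProbabilityMeasure_map h.aemeasurable

/-- Two points of the cylinder whose tails are coded into the same cell project to within r of each
other. Hence a cell containing a bad y contributes no more than the mass of the ball around the code
of y, which is below c Z μ[x|n]. The number of cells is at most a constant over Z, so Z cancels. -/
theorem measure_cylinder_inter_small_le (hd : 0 < d) (h0 : 0 ≤ ρ) (h1 : ρ < 1)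
    (hT : ∀ i, (T i).det ≠ 0) (hTρ : ∀ i, opNorm (T i) ≤ ρ) {a : Fin m → Euc d} {R : ℝ}
    (hR : 0 ≤ R) (haR : ∀ x, ‖codingMap T a x‖ ≤ R) (n : ℕ) {r : ℝ} (hr : 0 < r) (c : ℝ≥0∞)
    (x : Shift m) :
    μ ({y | projMeasure T a μ (Metric.closedBall (codingMap T a y) r) <
        c * (ENNReal.ofReal (truncRatio (prefixProd T y n) r) * μ (PiNat.cylinder y n))} ∩
        PiNat.cylinder x n) ≤
      (ENNReal.ofReal ((2 * R * √d + 2) ^ d) * c) * μ (PiNat.cylinder x n) := by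
  have hdet := det_prefixProd_ne_zero hT x n
  obtain ⟨F, q, hF, hq, hcard⟩ := exists_cells hd hdet hR hr
  set Z := truncRatio (prefixProd T x n) r with hZ
  have hle := measure_le_card_mul (μ := μ) (F := F) (q := fun y => q (codingMap T a (shiftBy n y)))
    (B := {y | projMeasure T a μ (Metric.closedBall (codingMap T a y) r) <
        c * (ENNReal.ofReal (truncRatio (prefixProd T y n) r) * μ (PiNat.cylinder y n))} ∩
        PiNat.cylinder x n) (c := c * (ENNReal.ofReal Z * μ (PiNat.cylinder x n)))
    (fun y _ => hF _ (haR _)) ?_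
  · refine hle.trans ?_
    calc (F.card : ℝ≥0∞) * (c * (ENNReal.ofReal Z * μ (PiNat.cylinder x n)))
        = ENNReal.ofReal (F.card * Z) * c * μ (PiNat.cylinder x n) := by
          rw [ENNReal.ofReal_mul (Nat.cast_nonneg _), ENNReal.ofReal_natCast]
          ring
      _ ≤ _ := by gcongr
  · rintro y ⟨hy, hyx⟩
    have hy' : projMeasure T a μ (Metric.closedBall (codingMap T a y) r) <
        c * (ENNReal.ofReal (truncRatio (prefixProd T y n) r) * μ (PiNat.cylinder y n)) := hy
    rw [PiNat.mem_cylinder_iff_eq.1 hyx, prefixProd_congr hyx] at hy'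
    refine le_trans ?_ hy'.le
    rw [projMeasure, Measure.map_apply (measurable_codingMap h0 h1 hTρ a)
      Metric.isClosed_closedBall.measurableSet]
    refine measure_mono ?_
    rintro z ⟨⟨-, hzx⟩, hz⟩
    have hzy : ∀ i < n, y i = z i := fun i hi => (hyx i hi).trans (hzx i hi).symm
    rw [Set.mem_preimage, Metric.mem_closedBall, dist_eq_norm, codingMap_sub h0 h1 hTρ a hzy,
      prefixProd_congr hzx]
    exact hq _ _ hz

theorem measure_small_le [IsProbabilityMeasure μ] (hd : 0 < d) (h0 : 0 ≤ ρ) (h1 : ρ < 1)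
    (hT : ∀ i, (T i).det ≠ 0) (hTρ : ∀ i, opNorm (T i) ≤ ρ) {a : Fin m → Euc d} {R : ℝ}
    (hR : 0 ≤ R) (haR : ∀ x, ‖codingMap T a x‖ ≤ R) (n : ℕ) {r : ℝ} (hr : 0 < r) (c : ℝ≥0∞) :
    μ {y | projMeasure T a μ (Metric.closedBall (codingMap T a y) r) <
        c * (ENNReal.ofReal (truncRatio (prefixProd T y n) r) * μ (PiNat.cylinder y n))} ≤
      ENNReal.ofReal ((2 * R * √d + 2) ^ d) * c := by
  have hq : Measurable fun (y : Shift m) (i : Fin n) => y i :=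
    measurable_pi_lambda _ fun i => measurable_pi_apply _
  refine (measure_le_mul_of_fiber hq (c := ENNReal.ofReal ((2 * R * √d + 2) ^ d) * c)
    fun x => ?_).trans (by simp)
  rw [← cylinder_eq_preimage]
  exact measure_cylinder_inter_small_le hd h0 h1 hT hTρ hR haR n hr c x

theorem summable_inv_sq (C : ℝ) : Summable fun j : ℕ => C * (((j : ℝ) + 1) ^ 2)⁻¹ := by
  have h := (summable_nat_add_iff 1).2 (Real.summable_nat_pow_inv.2 (one_lt_two : 1 < 2))
  simpa using h.mul_left C

/-- Almost surely, balls at dyadic scales are not much smaller than the cylinders predict. -/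
theorem ae_eventually_le_measure_closedBall [IsProbabilityMeasure μ] (hd : 0 < d) (h0 : 0 ≤ ρ)
    (h1 : ρ < 1) (hT : ∀ i, (T i).det ≠ 0) (hTρ : ∀ i, opNorm (T i) ≤ ρ) (a : Fin m → Euc d)
    (K : ℕ) :
    ∀ᵐ x ∂μ, ∀ᶠ j : ℕ in atTop, ∀ n ≤ K * j,
      ENNReal.ofReal (truncRatio (prefixProd T x n) (dyad j)) * μ (PiNat.cylinder x n) ≤
        ENNReal.ofReal (1 * ((j : ℝ) + 1) ^ 3) *
          projMeasure T a μ (Metric.closedBall (codingMap T a x) (dyad j)) := by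
  set R := (1 - ρ)⁻¹ * ‖a‖
  have hR : 0 ≤ R := mul_nonneg (inv_nonneg.2 (by linarith)) (norm_nonneg _)
  have haR : ∀ x, ‖codingMap T a x‖ ≤ R := norm_codingMap_le h0 h1 hTρ (norm_le_pi_norm a)
  set C := (2 * R * √d + 2) ^ d
  have hC : 0 ≤ C := by positivity
  -- The Kj + 1 lengths n cost one power of j + 1, so the exponent 3 leaves a summable inverse
  -- square.
  let c : ℕ → ℝ≥0∞ := fun j => ENNReal.ofReal ((((j : ℝ) + 1) ^ 3)⁻¹)
  let B : ℕ → ℕ → Set (Shift m) := fun j n =>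
    {y | projMeasure T a μ (Metric.closedBall (codingMap T a y) (dyad j)) <
        c j * (ENNReal.ofReal (truncRatio (prefixProd T y n) (dyad j)) *
          μ (PiNat.cylinder y n))}
  have hB : ∀ j, μ (⋃ n ∈ Finset.range (K * j + 1), B j n) ≤
      ENNReal.ofReal (C * (K + 1) * (((j : ℝ) + 1) ^ 2)⁻¹) := by
    intro j
    refine (measure_biUnion_finset_le _ _).trans ((Finset.sum_le_sum fun n _ =>
      measure_small_le hd h0 h1 hT hTρ hR haR n (dyad_pos j) (c j)).trans ?_)
    rw [Finset.sum_const, Finset.card_range, nsmul_eq_mul, ← ENNReal.ofReal_natCast,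
      ← ENNReal.ofReal_mul hC, ← ENNReal.ofReal_mul (Nat.cast_nonneg _)]
    refine ENNReal.ofReal_le_ofReal ?_
    have hj : (0 : ℝ) < j + 1 := by positivity
    have h3 : ((K * j + 1 : ℕ) : ℝ) ≤ (K + 1) * (j + 1) := by
      push_cast
      nlinarith [Nat.cast_nonneg (α := ℝ) K, Nat.cast_nonneg (α := ℝ) j]
    calc ((K * j + 1 : ℕ) : ℝ) * (C * (((j : ℝ) + 1) ^ 3)⁻¹)
        ≤ ((K + 1) * (j + 1)) * (C * (((j : ℝ) + 1) ^ 3)⁻¹) := by gcongr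
      _ = _ := by
        field_simp
  have hsum : ∑' j, μ (⋃ n ∈ Finset.range (K * j + 1), B j n) ≠ ∞ := by
    refine ne_top_of_le_ne_top ?_ (ENNReal.tsum_le_tsum hB)
    exact (summable_inv_sq _).tsum_ofReal_ne_top
  filter_upwards [ae_eventually_notMem hsum] with x hx
  filter_upwards [hx] with j hj n hn
  have hn' : x ∉ B j n := fun h => hj (Set.mem_iUnion₂.2
    ⟨n, Finset.mem_range.2 (Nat.lt_succ_of_le hn), h⟩)
  have hle : c j * (ENNReal.ofReal (truncRatio (prefixProd T x n) (dyad j)) *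
      μ (PiNat.cylinder x n)) ≤
      projMeasure T a μ (Metric.closedBall (codingMap T a x) (dyad j)) := not_lt.1 hn'
  have hj3 : (0 : ℝ) < ((j : ℝ) + 1) ^ 3 := by positivity
  calc _ = ENNReal.ofReal (1 * ((j : ℝ) + 1) ^ 3) * (c j *
        (ENNReal.ofReal (truncRatio (prefixProd T x n) (dyad j)) * μ (PiNat.cylinder x n))) := by
        rw [← mul_assoc (ENNReal.ofReal (1 * ((j : ℝ) + 1) ^ 3)), ← ENNReal.ofReal_mul (by positivity),
          one_mul, mul_inv_cancel₀ hj3.ne', ENNReal.ofReal_one, one_mul]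
    _ ≤ _ := by gcongr

/-- At scale 2^{-j} only prefixes of length at most Kj matter, so the number of relevant lengths is
linear in j. -/
theorem exists_pow_le_dyad (h0 : 0 ≤ ρ) (h1 : ρ < 1) : ∃ K : ℕ, ∀ j, ρ ^ (K * j) ≤ dyad j := by
  obtain ⟨K, hK⟩ := exists_pow_lt_of_lt_one (by norm_num : (0 : ℝ) < 1 / 2) h1
  refine ⟨K, fun j => ?_⟩
  rw [pow_mul]
  exact pow_le_pow_left₀ (pow_nonneg h0 K) hK.le j

/-- Summing over Kj + 1 lengths raises the polynomial degree by one. It is applied with g the mass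
of a ball and with g(j) = 2^{-js}. -/
theorem Gfun_le_mul_of_forall_le (h0 : 0 ≤ ρ) (hT : ∀ i, (T i).det ≠ 0)
    (hTρ : ∀ i, opNorm (T i) ≤ ρ) {K : ℕ} (hK : ∀ j, ρ ^ (K * j) ≤ dyad j) {x : Shift m}
    {g : ℕ → ℝ≥0∞} {C : ℝ} (hC : 0 ≤ C) {p j : ℕ}
    (h : ∀ n ≤ K * j, ENNReal.ofReal (truncRatio (prefixProd T x n) (dyad j)) *
      μ (PiNat.cylinder x n) ≤ ENNReal.ofReal (C * ((j : ℝ) + 1) ^ p) * g j) :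
    Gfun T μ x (dyad j) ≤ ENNReal.ofReal ((K + 1) * C * ((j : ℝ) + 1) ^ (p + 1)) * g j := by
  refine (Gfun_le_sum h0 hT hTρ x (dyad_pos j).le (hK j)).trans ?_
  refine (Finset.sum_le_sum fun n hn => h n (Nat.le_of_lt_succ (Finset.mem_range.1 hn))).trans ?_
  rw [Finset.sum_const, Finset.card_range, nsmul_eq_mul, ← mul_assoc, ← ENNReal.ofReal_natCast,
    ← ENNReal.ofReal_mul (Nat.cast_nonneg _)]
  refine mul_le_mul' (ENNReal.ofReal_le_ofReal ?_) le_rfl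
  have h3 : ((K * j + 1 : ℕ) : ℝ) ≤ (K + 1) * (j + 1) := by
    push_cast
    nlinarith [Nat.cast_nonneg (α := ℝ) K, Nat.cast_nonneg (α := ℝ) j]
  calc ((K * j + 1 : ℕ) : ℝ) * (C * ((j : ℝ) + 1) ^ p)
      ≤ ((K + 1) * (j + 1)) * (C * ((j : ℝ) + 1) ^ p) := by gcongr
    _ = _ := by ring

theorem svfExt_Sn (hd : 0 < d) (hT : ∀ i, (T i).det ≠ 0) (hT1 : ∀ i, opNorm (T i) < 1)
    [IsProbabilityMeasure μ] (x : Shift m) {n : ℕ} (hn : 0 < n) :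
    svfExt (Sn T μ x n) (prefixProd T x n) = μ.real (PiNat.cylinder x n) := by
  obtain ⟨t, ht, hu⟩ := existsUnique_svfExt_prefixProd hd T hT hT1 μ x hn
  have : {t : ℝ≥0∞ | svfExt t (prefixProd T x n) = μ.real (PiNat.cylinder x n)} = {t} :=
    Set.eq_singleton_iff_unique_mem.2 ⟨ht, hu⟩
  rw [Sn, this, sInf_singleton]
  exact ht

theorem opNorm_prefixProd_lt_one (h0 : 0 ≤ ρ) (h1 : ρ < 1) (hTρ : ∀ i, opNorm (T i) ≤ ρ)
    (x : Shift m) {n : ℕ} (hn : 0 < n) : opNorm (prefixProd T x n) < 1 :=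
  (opNorm_prefixProd_le h0 hTρ x n).trans_lt (pow_lt_one₀ h0 h1 hn.ne')

theorem svf_le_of_Sn_le (hd : 0 < d) (h0 : 0 ≤ ρ) (h1 : ρ < 1) (hT : ∀ i, (T i).det ≠ 0)
    (hTρ : ∀ i, opNorm (T i) ≤ ρ) [IsProbabilityMeasure μ] (x : Shift m) {n : ℕ} (hn : 0 < n)
    {s : ℝ} (hs : 0 ≤ s) (h : Sn T μ x n ≤ ENNReal.ofReal s) :
    svf s (prefixProd T x n) ≤ μ.real (PiNat.cylinder x n) := by
  have hdet := det_prefixProd_ne_zero hT x n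
  have htop : Sn T μ x n ≠ ∞ := ne_top_of_le_ne_top ENNReal.ofReal_ne_top h
  rw [← svfExt_Sn hd hT (fun i => (hTρ i).trans_lt h1) x hn, svfExt, if_neg htop,
    svf_eq_exp hdet hs, svf_eq_exp hdet ENNReal.toReal_nonneg]
  refine Real.exp_le_exp.2 ((logSvf_strictAntiOn hd hdet
    (opNorm_prefixProd_lt_one h0 h1 hTρ x hn)).antitoneOn ENNReal.toReal_nonneg hs ?_)
  exact ENNReal.toReal_le_of_le_ofReal hs h

theorem le_svf_of_le_Sn (hd : 0 < d) (h0 : 0 ≤ ρ) (h1 : ρ < 1) (hT : ∀ i, (T i).det ≠ 0)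
    (hTρ : ∀ i, opNorm (T i) ≤ ρ) [IsProbabilityMeasure μ] (x : Shift m) {n : ℕ} (hn : 0 < n)
    {s : ℝ} (hs : 0 ≤ s) (h : ENNReal.ofReal s ≤ Sn T μ x n) :
    μ.real (PiNat.cylinder x n) ≤ svf s (prefixProd T x n) := by
  have hdet := det_prefixProd_ne_zero hT x n
  rw [← svfExt_Sn hd hT (fun i => (hTρ i).trans_lt h1) x hn, svfExt, svf_eq_exp hdet hs]
  split_ifs with htop
  · exact (Real.exp_pos _).le
  rw [svf_eq_exp hdet ENNReal.toReal_nonneg]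
  refine Real.exp_le_exp.2 ((logSvf_strictAntiOn hd hdet
    (opNorm_prefixProd_lt_one h0 h1 hTρ x hn)).antitoneOn hs ENNReal.toReal_nonneg ?_)
  exact (ENNReal.ofReal_le_iff_le_toReal htop).1 h

variable [IsProbabilityMeasure μ]

/-- The empty prefix suffices: its cylinder has mass 1 and its ratio is at least r^d. -/
theorem liminf_dyadicRatio_le_dim (h1 : ρ < 1) (hTρ : ∀ i, opNorm (T i) ≤ ρ)
    (hT : ∀ i, (T i).det ≠ 0) {x : Shift m} {g : ℕ → ℝ≥0∞}
    (h : ∀ᶠ j : ℕ in atTop, ENNReal.ofReal (truncRatio (prefixProd T x 0) (dyad j)) *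
      μ (PiNat.cylinder x 0) ≤ ENNReal.ofReal (1 * ((j : ℝ) + 1) ^ 3) * g j) :
    liminf (dyadicRatio g) atTop ≤ ((d : ℝ) : EReal) := by
  have h2 : ∀ᶠ j : ℕ in atTop, ENNReal.ofReal (dyad j ^ (d : ℝ)) ≤
      ENNReal.ofReal (1 * ((j : ℝ) + 1) ^ 3) * g j := by
    filter_upwards [h] with j hj
    refine le_trans ?_ hj
    rw [PiNat.cylinder_zero, measure_univ, mul_one, Real.rpow_natCast]
    refine ENNReal.ofReal_le_ofReal (pow_le_truncRatio (det_prefixProd_ne_zero hT _ _) ?_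
      (dyad_pos j).le (dyad_le_one j))
    simpa using opNorm_prefixProd_le zero_le_one (fun i => (hTρ i).trans h1.le) x 0
  refine (liminf_dyadicRatio_le h2).trans ?_
  refine liminf_le_of_frequently_le (Eventually.frequently ?_) (by isBoundedDefault)
  filter_upwards [eventually_gt_atTop 0] with j hj
  exact (log_div_log_le_iff (dyad_pos j) (dyad_lt_one hj.ne')).2 le_rfl

/-- If S(μ,x) < s < d, then φ^s(T_{x|n}) ≤ μ[x|n] for infinitely many n. At the dyadic scale just
below α_{⌊s⌋+1}(T_{x|n}) this makes Z μ[x|n] at least 2^{-d} r^s. These scales tend to 0, so g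
reaches r^s up to a polynomial factor infinitely often. -/
theorem liminf_dyadicRatio_le_Sloc (hd : 0 < d) (h0 : 0 ≤ ρ) (h1 : ρ < 1)
    (hT : ∀ i, (T i).det ≠ 0) (hTρ : ∀ i, opNorm (T i) ≤ ρ) {K : ℕ}
    (hK : ∀ j, ρ ^ (K * j) ≤ dyad j) {x : Shift m} {g : ℕ → ℝ≥0∞}
    (h : ∀ᶠ j : ℕ in atTop, ∀ n ≤ K * j,
      ENNReal.ofReal (truncRatio (prefixProd T x n) (dyad j)) * μ (PiNat.cylinder x n) ≤
        ENNReal.ofReal (1 * ((j : ℝ) + 1) ^ 3) * g j) :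
    liminf (dyadicRatio g) atTop ≤ ((min (Sloc T μ x) (d : ℝ≥0∞) : ℝ≥0∞) : EReal) := by
  have hdim : liminf (dyadicRatio g) atTop ≤ ((d : ℝ) : EReal) :=
    liminf_dyadicRatio_le_dim h1 hTρ hT (h.mono fun j hj => hj 0 (Nat.zero_le _))
  refine EReal.le_of_forall_lt_iff_le.1 fun s hs => ?_
  rcases lt_or_ge s d with hsd | hsd
  swap
  · exact hdim.trans (by exact_mod_cast hsd)
  have hs0 : 0 ≤ s := by
    have : (0 : EReal) < s := lt_of_le_of_lt (EReal.coe_ennreal_nonneg _) hs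
    exact_mod_cast this.le
  have hSs : Sloc T μ x < ENNReal.ofReal s := by
    have h3 : min (Sloc T μ x) (d : ℝ≥0∞) < ENNReal.ofReal s := by
      rw [← EReal.coe_ennreal_lt_coe_ennreal_iff, EReal.coe_ennreal_ofReal, max_eq_left hs0]
      exact hs
    rcases min_lt_iff.1 h3 with h4 | h4
    · exact h4
    · rw [← ENNReal.ofReal_natCast, ENNReal.ofReal_lt_ofReal_iff_of_nonneg (Nat.cast_nonneg d)] at h4
      exact absurd h4 hsd.le.not_gt
  have hfreq : ∃ᶠ n in atTop, Sn T μ x n < ENNReal.ofReal s :=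
    frequently_lt_of_liminf_lt (by isBoundedDefault) hSs
  have key : ∃ᶠ j : ℕ in atTop, ENNReal.ofReal ((1 / 2) ^ d * dyad j ^ s) ≤
      ENNReal.ofReal (1 * ((j : ℝ) + 1) ^ 3) * g j := by
    rw [frequently_atTop]
    intro J
    obtain ⟨J', hJ'⟩ := eventually_atTop.1 h
    -- Taking n large pushes α_{⌊s⌋+1} ≤ ρ^n below 2^{-max(J, J')}, so the scale chosen from it lies
    -- beyond both thresholds.
    have hev : ∀ᶠ n : ℕ in atTop, 0 < n ∧ ρ ^ n ≤ dyad (max J J') :=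
      (eventually_gt_atTop 0).and
        ((tendsto_pow_atTop_nhds_zero_of_lt_one h0 h1).eventually_le_const (dyad_pos _))
    obtain ⟨n, hnS, hn0, hn⟩ := (hfreq.and_eventually hev).exists
    have hdet := det_prefixProd_ne_zero hT x n
    have hk : ⌊s⌋₊ < d := (Nat.floor_lt hs0).2 hsd
    set α := singVal (prefixProd T x n) ⌊s⌋₊ with hα
    have hα0 : 0 < α := singVal_pos hdet hk
    have hαn : α ≤ ρ ^ n := (singVal_le_opNorm _ hk).trans (opNorm_prefixProd_le h0 hTρ x n)
    obtain ⟨j, hj, hj1, hj2⟩ := exists_dyad_near hα0 (hαn.trans hn)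
    -- Otherwise α ≤ ρ^n ≤ 2^{-(j+1)}, contrary to the choice of j; so n is among the lengths
    -- covered at scale j + 1.
    have hnK : n ≤ K * (j + 1) := by
      by_contra! hlt
      have := (pow_le_pow_of_le_one h0 h1.le hlt.le).trans (hK (j + 1))
      exact absurd (hαn.trans this) hj1.not_ge
    refine ⟨j + 1, (le_max_left J J').trans (hj.trans j.le_succ), ?_⟩
    refine le_trans ?_ (hJ' (j + 1) ((le_max_right J J').trans (hj.trans j.le_succ)) n hnK)
    have hsvf := svf_le_of_Sn_le hd h0 h1 hT hTρ x hn0 hs0 hnS.le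
    have hge := rpow_le_truncRatio_mul_svf hdet (dyad_pos (j + 1)) hs0 hsd hj1.le
      (by rw [dyad_succ]; linarith)
    rw [← ENNReal.ofReal_toReal (measure_ne_top μ (PiNat.cylinder x n)),
      ← ENNReal.ofReal_mul (truncRatio_nonneg hdet (dyad_pos _).le)]
    refine ENNReal.ofReal_le_ofReal (hge.trans ?_)
    exact mul_le_mul_of_nonneg_left hsvf (truncRatio_nonneg hdet (dyad_pos _).le)
  -- A second slack t > s absorbs the factor 2^d (j+1)^3.
  refine EReal.le_of_forall_lt_iff_le.1 fun t ht => ?_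
  have hst : s < t := by exact_mod_cast ht
  have h2 := (tendsto_poly_mul_rpow_dyad (2 ^ d) 3 (sub_pos.2 hst)).eventually_le_const one_pos
  refine liminf_le_of_frequently_le ((key.and_eventually (h2.and (eventually_gt_atTop 0))).mono ?_)
    (by isBoundedDefault)
  rintro j ⟨hj1, hj2, hj0⟩
  rw [dyadicRatio, log_div_log_le_iff (dyad_pos j) (dyad_lt_one hj0.ne')]
  have hb : 0 < (2 : ℝ) ^ d * ((j : ℝ) + 1) ^ 3 := by positivity
  have hpos := Real.rpow_pos_of_pos (dyad_pos j) (t - s)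
  calc ENNReal.ofReal (dyad j ^ t)
      = ENNReal.ofReal (2 ^ d * dyad j ^ (t - s)) *
          ENNReal.ofReal ((1 / 2) ^ d * dyad j ^ s) := by
        rw [← ENNReal.ofReal_mul (by positivity)]
        congr 1
        have h5 : dyad j ^ t = dyad j ^ (t - s) * dyad j ^ s := by
          rw [← Real.rpow_add (dyad_pos j), sub_add_cancel]
        have h6 : (2 : ℝ) ^ d * (1 / 2) ^ d = 1 := by rw [← mul_pow]; norm_num
        rw [h5]
        linear_combination (-(dyad j ^ (t - s) * dyad j ^ s)) * h6
    _ ≤ ENNReal.ofReal (2 ^ d * dyad j ^ (t - s)) *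
          (ENNReal.ofReal (1 * ((j : ℝ) + 1) ^ 3) * g j) := by gcongr
    _ = ENNReal.ofReal (2 ^ d * ((j : ℝ) + 1) ^ 3 * dyad j ^ (t - s)) * g j := by
        rw [← mul_assoc, ← ENNReal.ofReal_mul (by positivity)]
        congr 2
        ring
    _ ≤ 1 * g j := by
        gcongr
        exact ENNReal.ofReal_le_one.2 hj2
    _ = g j := one_mul _

/-- The upper bounds for the local dimensions. -/
theorem ae_locDim_le (hd : 0 < d) (h0 : 0 ≤ ρ) (h1 : ρ < 1) (hT : ∀ i, (T i).det ≠ 0)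
    (hTρ : ∀ i, opNorm (T i) ≤ ρ) (a : Fin m → Euc d) :
    ∀ᵐ x ∂μ,
      lowerLocDim (projMeasure T a μ) (codingMap T a x) ≤
          ((min (Sloc T μ x) (d : ℝ≥0∞) : ℝ≥0∞) : EReal) ∧
      upperLocDim (projMeasure T a μ) (codingMap T a x) ≤ Dloc T μ x := by
  obtain ⟨K, hK⟩ := exists_pow_le_dyad h0 h1
  have := isProbabilityMeasure_projMeasure (μ := μ) (measurable_codingMap h0 h1 hTρ a)
  filter_upwards [ae_eventually_le_measure_closedBall (μ := μ) hd h0 h1 hT hTρ a K] with x hx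
  rw [lowerLocDim_eq, upperLocDim_eq, Dloc_eq hT]
  refine ⟨liminf_dyadicRatio_le_Sloc hd h0 h1 hT hTρ hK hx, ?_⟩
  refine limsup_dyadicRatio_le (C := (K + 1) * 1) (p := 4) ?_
  filter_upwards [hx] with j hj
  exact Gfun_le_mul_of_forall_le (p := 3)
    (g := fun j => projMeasure T a μ (Metric.closedBall (codingMap T a x) (dyad j)))
    h0 hT hTρ hK zero_le_one hj

/-- For large n, μ[x|n] ≤ φ^s(T_{x|n}), so each term Z μ[x|n] is at most r^s. The finitely many
short prefixes are handled by Z ≤ r^d/|det| and r^d ≤ r^s, which produces the constant depending on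
x. -/
theorem Gfun_dyad_le (hd : 0 < d) (h0 : 0 ≤ ρ) (h1 : ρ < 1) (hT : ∀ i, (T i).det ≠ 0)
    (hTρ : ∀ i, opNorm (T i) ≤ ρ) {K : ℕ} (hK : ∀ j, ρ ^ (K * j) ≤ dyad j) (x : Shift m) {s : ℝ}
    (hs0 : 0 ≤ s) (hsd : s < d) (hsS : ENNReal.ofReal s < Sloc T μ x) :
    ∃ C : ℝ, ∀ j : ℕ, Gfun T μ x (dyad j) ≤
      ENNReal.ofReal (C * ((j : ℝ) + 1) ^ 1) * ENNReal.ofReal (dyad j ^ s) := by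
  obtain ⟨N, hN⟩ := eventually_atTop.1 ((eventually_lt_of_lt_liminf hsS).and
    (eventually_gt_atTop 0))
  set C := 1 + ∑ n ∈ Finset.range N, |(prefixProd T x n).det|⁻¹ with hC
  have hsum0 : 0 ≤ ∑ n ∈ Finset.range N, |(prefixProd T x n).det|⁻¹ :=
    Finset.sum_nonneg fun n _ => inv_nonneg.2 (abs_nonneg _)
  have hC1 : 1 ≤ C := by linarith
  refine ⟨(K + 1) * C, fun j => ?_⟩
  refine Gfun_le_mul_of_forall_le (p := 0) (g := fun j => ENNReal.ofReal (dyad j ^ s)) h0 hT hTρ hK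
    (zero_le_one.trans hC1) fun n _ => ?_
  have hdet := det_prefixProd_ne_zero hT x n
  have hZ0 := truncRatio_nonneg hdet (dyad_pos j).le
  have hpos := Real.rpow_nonneg (dyad_pos j).le s
  rw [pow_zero, mul_one, ← ENNReal.ofReal_mul (zero_le_one.trans hC1)]
  rcases lt_or_ge n N with hn | hn
  · refine (mul_le_of_le_one_right zero_le prob_le_one).trans (ENNReal.ofReal_le_ofReal ?_)
    refine (truncRatio_le_div_pow (dyad_pos j).le).trans ?_
    rw [div_eq_mul_inv, mul_comm]
    refine mul_le_mul ?_ ?_ (pow_nonneg (dyad_pos j).le _) (zero_le_one.trans hC1)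
    · have := Finset.single_le_sum (f := fun n => |(prefixProd T x n).det|⁻¹)
        (fun n _ => inv_nonneg.2 (abs_nonneg _)) (Finset.mem_range.2 hn)
      linarith
    · rw [← Real.rpow_natCast]
      exact Real.rpow_le_rpow_of_exponent_ge (dyad_pos j) (dyad_le_one j) hsd.le
  · obtain ⟨hS, hn0⟩ := hN n hn
    rw [← ENNReal.ofReal_toReal (measure_ne_top μ (PiNat.cylinder x n)),
      ← ENNReal.ofReal_mul hZ0]
    refine ENNReal.ofReal_le_ofReal ?_
    calc _ ≤ truncRatio (prefixProd T x n) (dyad j) * svf s (prefixProd T x n) :=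
          mul_le_mul_of_nonneg_left (le_svf_of_le_Sn hd h0 h1 hT hTρ x hn0 hs0 hS.le) hZ0
      _ ≤ dyad j ^ s := truncRatio_mul_svf_le hdet (dyad_pos j) hs0 hsd
      _ ≤ C * dyad j ^ s := le_mul_of_one_le_left hpos hC1

theorem min_Sloc_le_liminf (hd : 0 < d) (h0 : 0 ≤ ρ) (h1 : ρ < 1) (hT : ∀ i, (T i).det ≠ 0)
    (hTρ : ∀ i, opNorm (T i) ≤ ρ) (x : Shift m) :
    ((min (Sloc T μ x) (d : ℝ≥0∞) : ℝ≥0∞) : EReal) ≤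
      liminf (dyadicRatio fun j => Gfun T μ x (dyad j)) atTop := by
  obtain ⟨K, hK⟩ := exists_pow_le_dyad h0 h1
  refine EReal.ge_of_forall_gt_iff_ge.1 fun s hs => ?_
  rcases lt_or_ge s 0 with hneg | hs0
  · refine le_liminf_of_le (by isBoundedDefault) ?_
    filter_upwards [eventually_gt_atTop 0] with j hj
    rw [dyadicRatio, le_log_div_log_iff (dyad_pos j) (dyad_lt_one hj.ne')]
    refine (Gfun_le_one hT x (dyad_pos j).le).trans (ENNReal.one_le_ofReal.2 ?_)
    exact Real.one_le_rpow_of_pos_of_le_one_of_nonpos (dyad_pos j) (dyad_le_one j) hneg.le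
  have h3 : ENNReal.ofReal s < min (Sloc T μ x) (d : ℝ≥0∞) := by
    rw [← EReal.coe_ennreal_lt_coe_ennreal_iff, EReal.coe_ennreal_ofReal, max_eq_left hs0]
    exact hs
  obtain ⟨h4, h5⟩ := lt_min_iff.1 h3
  have hsd : s < d := by
    rw [← ENNReal.ofReal_natCast, ENNReal.ofReal_lt_ofReal_iff_of_nonneg hs0] at h5
    exact h5
  obtain ⟨C, hC⟩ := Gfun_dyad_le hd h0 h1 hT hTρ hK x hs0 hsd h4
  refine le_trans ?_ (liminf_dyadicRatio_le (Eventually.of_forall hC))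
  refine le_liminf_of_le (by isBoundedDefault) ?_
  filter_upwards [eventually_gt_atTop 0] with j hj
  exact (le_log_div_log_iff (dyad_pos j) (dyad_lt_one hj.ne')).2 le_rfl

end Upper

/-! ### Transversality -/

section Transversality

variable {m d : ℕ} {T : Fin m → Matrix (Fin d) (Fin d) ℝ} {ρ : ℝ}

/-- The `k`-th summand of the linear dependence of `π^a x` on the translation `a_i`. -/
def letterTerm (T : Fin m → Matrix (Fin d) (Fin d) ℝ) (x : Shift m) (i : Fin m) (k : ℕ) :
    Euc d →L[ℝ] Euc d :=
  if x k = i then Matrix.toEuclideanCLM (n := Fin d) (𝕜 := ℝ) (prefixProd T x k) else 0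

theorem norm_letterTerm_le (h0 : 0 ≤ ρ) (hTρ : ∀ i, opNorm (T i) ≤ ρ) (x : Shift m) (i : Fin m)
    (k : ℕ) : ‖letterTerm T x i k‖ ≤ if x k = i then ρ ^ k else 0 := by
  rw [letterTerm]
  split_ifs
  · exact opNorm_prefixProd_le h0 hTρ x k
  · rw [norm_zero]

theorem ite_pow_nonneg (h0 : 0 ≤ ρ) (x : Shift m) (i : Fin m) (k : ℕ) :
    0 ≤ if x k = i then ρ ^ k else 0 := by
  split_ifs
  · exact pow_nonneg h0 k
  · exact le_rfl

theorem summable_ite_pow (h0 : 0 ≤ ρ) (h1 : ρ < 1) (x : Shift m) (i : Fin m) :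
    Summable fun k => if x k = i then ρ ^ k else 0 :=
  Summable.of_nonneg_of_le (ite_pow_nonneg h0 x i) (fun k => by
    split_ifs
    · exact le_rfl
    · exact pow_nonneg h0 k) (summable_geometric_of_lt_one h0 h1)

theorem summable_letterTerm (h0 : 0 ≤ ρ) (h1 : ρ < 1) (hTρ : ∀ i, opNorm (T i) ≤ ρ)
    (x : Shift m) (i : Fin m) : Summable (letterTerm T x i) :=
  Summable.of_norm_bounded (summable_ite_pow h0 h1 x i) (norm_letterTerm_le h0 hTρ x i)

/-- The linear dependence of `π^a x` on the translation `a_i`. -/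
def letterOp (T : Fin m → Matrix (Fin d) (Fin d) ℝ) (x : Shift m) (i : Fin m) :
    Euc d →L[ℝ] Euc d := ∑' k, letterTerm T x i k

/-- With the other translations frozen, the code is affine in a_i; this allows slicing parameter
space along a single letter. -/
theorem codingMap_update (h0 : 0 ≤ ρ) (h1 : ρ < 1) (hTρ : ∀ i, opNorm (T i) ≤ ρ)
    (a : Fin m → Euc d) (x : Shift m) (i : Fin m) (u : Euc d) :
    codingMap T (Function.update a i u) x =
      letterOp T x i u + codingMap T (Function.update a i 0) x := by
  have hs := summable_letterTerm h0 h1 hTρ x i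
  have e : letterOp T x i u = ∑' k, letterTerm T x i k u :=
    (ContinuousLinearMap.apply ℝ (Euc d) u).map_tsum hs
  have hs' : Summable fun k => letterTerm T x i k u :=
    hs.mapL (ContinuousLinearMap.apply ℝ (Euc d) u)
  rw [codingMap_eq_tsum h0 h1 hTρ, codingMap_eq_tsum h0 h1 hTρ, e,
    ← hs'.tsum_add (summable_codingMap h0 h1 hTρ _ x)]
  refine tsum_congr fun k => ?_
  rw [letterTerm]
  split_ifs with h
  · simp [h]
  · simp [Function.update_of_ne h]

/-- The weight of the occurrences of the letter `i` in `x` after the first symbol. -/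
def tailWeight (ρ : ℝ) (x : Shift m) (i : Fin m) : ℝ :=
  ∑' k, if x (k + 1) = i then ρ ^ (k + 1) else 0

theorem norm_letterOp_sub_le (h0 : 0 ≤ ρ) (h1 : ρ < 1) (hTρ : ∀ i, opNorm (T i) ≤ ρ)
    (x : Shift m) (i : Fin m) :
    ‖letterOp T x i - (if x 0 = i then ContinuousLinearMap.id ℝ (Euc d) else 0)‖ ≤
      tailWeight ρ x i := by
  have hs := summable_letterTerm h0 h1 hTρ x i
  have hz : letterTerm T x i 0 = if x 0 = i then ContinuousLinearMap.id ℝ (Euc d) else 0 := by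
    rw [letterTerm, prefixProd, map_one]
    rfl
  rw [letterOp, hs.tsum_eq_zero_add, hz, add_sub_cancel_left]
  exact tsum_of_norm_bounded ((summable_nat_add_iff 1).2 (summable_ite_pow h0 h1 x i)).hasSum
    fun k => norm_letterTerm_le h0 hTρ x i (k + 1)

/-- Each position holds at most one of the two letters, so both weights together are dominated by
one geometric series. -/
theorem tailWeight_add_le (h0 : 0 ≤ ρ) (h1 : ρ < 1) (x : Shift m) {i j : Fin m} (hij : i ≠ j) :
    tailWeight ρ x i + tailWeight ρ x j ≤ ρ / (1 - ρ) := by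
  have hs := fun l => (summable_nat_add_iff 1).2 (summable_ite_pow h0 h1 x l)
  have hg : HasSum (fun k : ℕ => ρ ^ (k + 1)) (ρ / (1 - ρ)) := by
    have := (hasSum_geometric_of_lt_one h0 h1).mul_left ρ
    simpa only [pow_succ', div_eq_mul_inv] using this
  rw [tailWeight, tailWeight, ← (hs i).tsum_add (hs j), ← hg.tsum_eq]
  refine ((hs i).add (hs j)).tsum_le_tsum (fun k => ?_) hg.summable
  have := pow_nonneg h0 (k + 1)
  by_cases hi : x (k + 1) = i
  · have hj : x (k + 1) ≠ j := fun h => hij (hi.symm.trans h)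
    simp [hi, hij]
  · by_cases hj : x (k + 1) = j
    · simp [hj, hij.symm]
    · simp [hi, hj, this]

theorem one_sub_mul_norm_le {L E : Euc d →L[ℝ] Euc d} {c : ℝ} (hE : ‖E‖ ≤ c)
    (h : ∀ u, ‖u‖ ≤ ‖L u‖ + ‖E u‖) (u : Euc d) : (1 - c) * ‖u‖ ≤ ‖L u‖ := by
  have h1 : ‖E u‖ ≤ c * ‖u‖ :=
    (E.le_opNorm u).trans (mul_le_mul_of_nonneg_right hE (norm_nonneg u))
  linarith [h u]

/-- If `x` and `y` have different first symbols, then `π^a x - π^a y` depends on one of the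
translations through a uniformly expanding linear map. -/
theorem exists_letter_expanding (h0 : 0 ≤ ρ) (h1 : ρ < 1) (hTρ : ∀ i, opNorm (T i) ≤ ρ)
    {x y : Shift m} (hxy : x 0 ≠ y 0) :
    ∃ i, ∀ u, (1 - ρ / (1 - ρ)) * ‖u‖ ≤ ‖(letterOp T x i - letterOp T y i) u‖ := by
  have hi1 := norm_letterOp_sub_le h0 h1 hTρ x (x 0)
  have hi2 := norm_letterOp_sub_le h0 h1 hTρ y (x 0)
  have hj1 := norm_letterOp_sub_le h0 h1 hTρ x (y 0)
  have hj2 := norm_letterOp_sub_le h0 h1 hTρ y (y 0)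
  rw [if_pos rfl] at hi1 hj2
  rw [if_neg hxy.symm, sub_zero] at hi2
  rw [if_neg hxy, sub_zero] at hj1
  have hx := tailWeight_add_le h0 h1 x hxy
  have hy := tailWeight_add_le h0 h1 y hxy
  -- The four weights total at most 2ρ/(1−ρ), so one of the two letters carries at most half. Being
  -- free to choose the letter is what makes the threshold 1/2.
  have hcase : tailWeight ρ x (x 0) + tailWeight ρ y (x 0) ≤ ρ / (1 - ρ) ∨
      tailWeight ρ x (y 0) + tailWeight ρ y (y 0) ≤ ρ / (1 - ρ) := by
    by_contra! h
    linarith [h.1, h.2]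
  rcases hcase with h | h
  · refine ⟨x 0, one_sub_mul_norm_le (E := (letterOp T x (x 0) - ContinuousLinearMap.id ℝ (Euc d)) -
      letterOp T y (x 0)) (((norm_sub_le _ _).trans (add_le_add hi1 hi2)).trans h) fun u => ?_⟩
    have : u = (letterOp T x (x 0) - letterOp T y (x 0)) u -
        ((letterOp T x (x 0) - ContinuousLinearMap.id ℝ (Euc d)) - letterOp T y (x 0)) u := by
      simp
    calc ‖u‖ = _ := congrArg norm this
      _ ≤ _ := norm_sub_le _ _
  · refine ⟨y 0, one_sub_mul_norm_le (E := letterOp T x (y 0) -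
      (letterOp T y (y 0) - ContinuousLinearMap.id ℝ (Euc d)))
      (((norm_sub_le _ _).trans (add_le_add hj1 hj2)).trans h) fun u => ?_⟩
    have : u = (letterOp T x (y 0) - (letterOp T y (y 0) - ContinuousLinearMap.id ℝ (Euc d))) u -
        (letterOp T x (y 0) - letterOp T y (y 0)) u := by
      simp
    calc ‖u‖ = _ := congrArg norm this
      _ ≤ _ := norm_sub_le _ _
      _ = _ := add_comm _ _

/-- Expansion makes L invertible. Its inverse determinant is read off from the unit ball, whose
preimage lies in the ball of radius 1/κ. -/
theorem volume_affine_preimage_le {L : Euc d →L[ℝ] Euc d} {κ : ℝ} (hκ : 0 < κ)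
    (hL : ∀ u, κ * ‖u‖ ≤ ‖L u‖) (b : Euc d) (V : Set (Euc d)) :
    volume {u | L u + b ∈ V} ≤ ENNReal.ofReal (κ⁻¹ ^ d) * volume V := by
  have hdet : LinearMap.det (L : Euc d →ₗ[ℝ] Euc d) ≠ 0 := by
    intro h
    have h2 := LinearMap.bot_lt_ker_of_det_eq_zero h
    refine h2.ne' (LinearMap.ker_eq_bot'.2 fun u hu => ?_)
    have h3 := hL u
    have h4 : L u = 0 := hu
    rw [h4, norm_zero] at h3
    exact norm_le_zero_iff.1 (nonpos_of_mul_nonpos_right h3 hκ)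
  have hpre := fun s => Measure.addHaar_preimage_linearMap (volume : Measure (Euc d)) hdet s
  have hle : ENNReal.ofReal |(LinearMap.det (L : Euc d →ₗ[ℝ] Euc d))⁻¹| ≤
      ENNReal.ofReal (κ⁻¹ ^ d) := by
    have h1 : volume (Metric.closedBall (0 : Euc d) 1) ≠ 0 :=
      (Metric.measure_closedBall_pos _ _ one_pos).ne'
    have h2 : volume (Metric.closedBall (0 : Euc d) 1) ≠ ∞ := measure_closedBall_lt_top.ne
    refine (ENNReal.mul_le_mul_iff_left h1 h2).1 ?_
    rw [← hpre]
    have h3 := Measure.addHaar_closedBall_mul (volume : Measure (Euc d)) (0 : Euc d)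
      (inv_nonneg.2 hκ.le) (zero_le_one)
    rw [finrank_euclideanSpace_fin, mul_one] at h3
    rw [← h3]
    refine measure_mono fun u hu => ?_
    have hu' : ‖L u‖ ≤ 1 := by simpa using hu
    rw [mem_closedBall_zero_iff, ← one_div, le_div_iff₀ hκ, mul_comm]
    exact (hL u).trans hu'
  calc volume {u | L u + b ∈ V}
      = volume ((L : Euc d →ₗ[ℝ] Euc d) ⁻¹' ((fun v => v + b) ⁻¹' V)) := rfl
    _ = ENNReal.ofReal |(LinearMap.det (L : Euc d →ₗ[ℝ] Euc d))⁻¹| * volume V := by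
      rw [hpre, measure_preimage_add_right]
    _ ≤ _ := by gcongr

/-- The set of translations bounded by `R`. -/
def transBox (m d : ℕ) (R : ℝ) : Set (Fin m → Euc d) :=
  Set.univ.pi fun _ => Metric.closedBall 0 R

theorem mem_transBox {R : ℝ} {a : Fin m → Euc d} : a ∈ transBox m d R ↔ ∀ i, ‖a i‖ ≤ R := by
  simp [transBox]

theorem measurableSet_transBox (R : ℝ) : MeasurableSet (transBox m d R) :=
  MeasurableSet.univ_pi fun _ => Metric.isClosed_closedBall.measurableSet

theorem volume_transBox_lt_top (R : ℝ) : volume (transBox m d R) < ∞ := by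
  rw [transBox, volume_pi_pi]
  exact ENNReal.prod_lt_top fun _ _ => measure_closedBall_lt_top

theorem measurable_codingMap_left (h0 : 0 ≤ ρ) (h1 : ρ < 1) (hTρ : ∀ i, opNorm (T i) ≤ ρ)
    (x : Shift m) : Measurable fun a : Fin m → Euc d => codingMap T a x :=
  (measurable_codingMap_uncurry h0 h1 hTρ).comp measurable_prodMk_right

/-- On the slice, the difference of the two tails is an expanding affine function of u. It stays in
the ball of radius R', and T_{x|n} maps it into the r-ball, so it lies in a truncated ellipsoid. -/
theorem volume_slice_le (h0 : 0 ≤ ρ) (h1 : ρ < 1) (hT : ∀ i, (T i).det ≠ 0)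
    (hTρ : ∀ i, opNorm (T i) ≤ ρ) {x y : Shift m} {i : Fin m} {n : ℕ}
    (hn : ∀ k < n, y k = x k) {κ : ℝ} (hκ : 0 < κ)
    (hi : ∀ u, κ * ‖u‖ ≤ ‖(letterOp T (shiftBy n x) i - letterOp T (shiftBy n y) i) u‖)
    {R R' r : ℝ} (hr : 0 < r) (hR' : 1 ≤ R') (hRR' : 2 * ((1 - ρ)⁻¹ * R) ≤ R')
    (a : Fin m → Euc d) :
    volume {u | ‖codingMap T (Function.update a i u) x -
        codingMap T (Function.update a i u) y‖ ≤ r ∧ Function.update a i u ∈ transBox m d R} ≤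
      ENNReal.ofReal (κ⁻¹ ^ d) * ENNReal.ofReal ((2 * R') ^ d * truncRatio (prefixProd T x n) r) := by
  refine le_trans (measure_mono ?_) ((volume_affine_preimage_le hκ hi
    (codingMap T (Function.update a i 0) (shiftBy n x) -
      codingMap T (Function.update a i 0) (shiftBy n y)) _).trans
    (mul_le_mul_right (volume_ellipsoid_le (det_prefixProd_ne_zero hT x n) hR' hr) _))
  rintro u ⟨hu1, hu2⟩
  have hbound := mem_transBox.1 hu2
  have e : (letterOp T (shiftBy n x) i - letterOp T (shiftBy n y) i) u +
      (codingMap T (Function.update a i 0) (shiftBy n x) -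
        codingMap T (Function.update a i 0) (shiftBy n y)) =
      codingMap T (Function.update a i u) (shiftBy n x) -
        codingMap T (Function.update a i u) (shiftBy n y) := by
    rw [codingMap_update h0 h1 hTρ a (shiftBy n x) i u,
      codingMap_update h0 h1 hTρ a (shiftBy n y) i u, sub_apply]
    abel
  show _ ∧ _
  rw [e, ← codingMap_sub h0 h1 hTρ _ hn]
  refine ⟨(norm_sub_le _ _).trans ?_, hu1⟩
  have hx := norm_codingMap_le h0 h1 hTρ hbound (shiftBy n x)
  have hy := norm_codingMap_le h0 h1 hTρ hbound (shiftBy n y)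
  linarith

/-- Tonelli with the i-th translation integrated first; the other m − 1 translations contribute the
volume of a ball each. -/
theorem pi_restrict_measure_le (S : Set (Fin m → Euc d)) (hS : MeasurableSet S) (R : ℝ)
    (i : Fin m) {c : ℝ≥0∞} (h : ∀ a, volume {u | Function.update a i u ∈ S} ≤ c) :
    volume.restrict (transBox m d R) S ≤
      c * volume (Metric.closedBall (0 : Euc d) R) ^ (m - 1) := by
  let ν : Fin m → Measure (Euc d) := fun _ => volume.restrict (Metric.closedBall 0 R)
  have hν : (volume.restrict (transBox m d R) : Measure (Fin m → Euc d)) = Measure.pi ν :=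
    Measure.restrict_pi_pi _ _
  have hm : Measurable (S.indicator (1 : (Fin m → Euc d) → ℝ≥0∞)) := measurable_one.indicator hS
  rw [hν, ← lintegral_indicator_one hS, lintegral_eq_lmarginal_univ (μ := ν) 0,
    lmarginal_erase' _ hm (Finset.mem_univ i)]
  have hin : (fun a : Fin m → Euc d => ∫⁻ u, S.indicator (1 : (Fin m → Euc d) → ℝ≥0∞)
      (Function.update a i u) ∂ν i) ≤ fun _ => c := by
    intro a
    refine le_trans ?_ (h a)
    have hpre : MeasurableSet {u | Function.update a i u ∈ S} := (measurable_update a) hS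
    calc ∫⁻ u, S.indicator (1 : (Fin m → Euc d) → ℝ≥0∞) (Function.update a i u) ∂ν i
        = ∫⁻ u, {u | Function.update a i u ∈ S}.indicator 1 u ∂ν i := rfl
      _ = ν i {u | Function.update a i u ∈ S} := lintegral_indicator_one hpre
      _ ≤ _ := Measure.restrict_apply_le _ _
  refine (lmarginal_mono hin 0).trans (le_of_eq ?_)
  rw [lmarginal, lintegral_const, Measure.pi_univ]
  simp [ν]

/-- The transversality estimate. -/
theorem exists_transversality (h0 : 0 ≤ ρ) (h1 : ρ < 1 / 2) (hT : ∀ i, (T i).det ≠ 0)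
    (hTρ : ∀ i, opNorm (T i) ≤ ρ) (R : ℝ) :
    ∃ C : ℝ≥0∞, C ≠ ∞ ∧ ∀ (x y : Shift m) (r : ℝ), 0 < r →
      volume.restrict (transBox m d R) {a | dist (codingMap T a y) (codingMap T a x) ≤ r} ≤
        C * ENNReal.ofReal (Zfun T x y r) := by
  have h1' : ρ < 1 := by linarith
  -- The expansion constant; it is positive because ρ < 1/2.
  set κ := 1 - ρ / (1 - ρ)
  have hκ : 0 < κ := sub_pos.2 ((div_lt_one (by linarith)).2 (by linarith))
  set R' := max 1 (2 * ((1 - ρ)⁻¹ * R))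
  have hR' : 1 ≤ R' := le_max_left _ _
  set C₁ := ENNReal.ofReal (κ⁻¹ ^ d) * ENNReal.ofReal ((2 * R') ^ d) *
    volume (Metric.closedBall (0 : Euc d) R) ^ (m - 1) with hC₁
  have hC₁top : C₁ ≠ ∞ := ENNReal.mul_ne_top
    (ENNReal.mul_ne_top ENNReal.ofReal_ne_top ENNReal.ofReal_ne_top)
    (ENNReal.pow_ne_top measure_closedBall_lt_top.ne)
  -- The volume of the box is added for the case x = y, where Z = 1 and every translation qualifies.
  refine ⟨C₁ + volume (transBox m d R), ENNReal.add_ne_top.2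
    ⟨hC₁top, (volume_transBox_lt_top R).ne⟩, fun x y r hr => ?_⟩
  rcases eq_or_ne x y with rfl | hne
  · rw [Zfun_self, ENNReal.ofReal_one, mul_one]
    refine (measure_mono (Set.subset_univ _)).trans ?_
    rw [Measure.restrict_apply_univ]
    exact le_add_self
  refine le_trans ?_ (mul_le_mul_left le_self_add _)
  set n := PiNat.firstDiff x y with hn
  have hagree : ∀ k < n, y k = x k := fun k hk => (PiNat.apply_eq_of_lt_firstDiff hk).symm
  have hdiff : shiftBy n x 0 ≠ shiftBy n y 0 := PiNat.apply_firstDiff_ne hne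
  obtain ⟨i, hi⟩ := exists_letter_expanding h0 h1' hTρ hdiff
  set S := {a : Fin m → Euc d | ‖codingMap T a x - codingMap T a y‖ ≤ r ∧ a ∈ transBox m d R}
  have hSm : MeasurableSet S :=
    (measurableSet_le ((measurable_codingMap_left h0 h1' hTρ x).sub
      (measurable_codingMap_left h0 h1' hTρ y)).norm measurable_const).inter
      (measurableSet_transBox R)
  have hSle := pi_restrict_measure_le S hSm R i
    (volume_slice_le h0 h1' hT hTρ hagree hκ hi hr hR' (le_max_right _ _))
  calc volume.restrict (transBox m d R) {a | dist (codingMap T a y) (codingMap T a x) ≤ r}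
      ≤ volume.restrict (transBox m d R) S := by
        rw [Measure.restrict_apply' (measurableSet_transBox R),
          Measure.restrict_apply' (measurableSet_transBox R)]
        refine measure_mono ?_
        rintro a ⟨ha1, ha2⟩
        refine ⟨⟨?_, ha2⟩, ha2⟩
        rw [← dist_eq_norm, dist_comm]
        exact ha1
    _ ≤ _ := hSle
    _ = C₁ * ENNReal.ofReal (Zfun T x y r) := by
      rw [Zfun_of_ne hne, ENNReal.ofReal_mul (by positivity), hC₁]
      ring

end Transversality

/-! ### Lower bounds for almost every translation -/

/-- Markov's inequality gives exceptional sets of measure at most C/(j+1)^2, and Borel–Cantelli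
applies. Since g is nonzero and finite, it cancels. -/
theorem ae_eventually_le_of_lintegral_le {X : Type*} [MeasurableSpace X] {ν : Measure X}
    {H : ℕ → X → ℝ≥0∞} (hH : ∀ j, Measurable (H j)) {g : ℕ → ℝ≥0∞} (hg0 : ∀ j, g j ≠ 0)
    (hgtop : ∀ j, g j ≠ ∞) {C : ℝ≥0∞} (hC : C ≠ ∞) (h : ∀ j, ∫⁻ a, H j a ∂ν ≤ C * g j) :
    ∀ᵐ a ∂ν, ∀ᶠ j : ℕ in atTop, H j a ≤ ENNReal.ofReal (1 * ((j : ℝ) + 1) ^ 2) * g j := by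
  have hq0 : ∀ j : ℕ, ENNReal.ofReal (1 * ((j : ℝ) + 1) ^ 2) ≠ 0 := fun j =>
    (ENNReal.ofReal_pos.2 (by positivity)).ne'
  have hB : ∀ j : ℕ, ν {a | ENNReal.ofReal (1 * ((j : ℝ) + 1) ^ 2) * g j ≤ H j a} ≤
      C * ENNReal.ofReal (1 * (((j : ℝ) + 1) ^ 2)⁻¹) := by
    intro j
    refine (meas_ge_le_lintegral_div (hH j).aemeasurable (mul_ne_zero (hq0 j) (hg0 j))
      (ENNReal.mul_ne_top ENNReal.ofReal_ne_top (hgtop j))).trans ?_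
    refine (ENNReal.div_le_div_right (h j) _).trans (le_of_eq ?_)
    rw [ENNReal.mul_div_mul_right _ _ (hg0 j) (hgtop j), ENNReal.div_eq_inv_mul, mul_comm,
      ← ENNReal.ofReal_inv_of_pos (by positivity), mul_inv, inv_one]
  have hsum : ∑' j : ℕ, ν {a | ENNReal.ofReal (1 * ((j : ℝ) + 1) ^ 2) * g j ≤ H j a} ≠ ∞ := by
    refine ne_top_of_le_ne_top ?_ (ENNReal.tsum_le_tsum hB)
    rw [ENNReal.tsum_mul_left]
    exact ENNReal.mul_ne_top hC (summable_inv_sq 1).tsum_ofReal_ne_top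
  filter_upwards [ae_eventually_notMem hsum] with a ha
  filter_upwards [ha] with j hj
  exact (not_le.1 hj).le

section Lower

variable {m d : ℕ} {T : Fin m → Matrix (Fin d) (Fin d) ℝ} {ρ : ℝ} {μ : Measure (Shift m)}

theorem projMeasure_closedBall (h0 : 0 ≤ ρ) (h1 : ρ < 1) (hTρ : ∀ i, opNorm (T i) ≤ ρ)
    (a : Fin m → Euc d) (x : Shift m) (r : ℝ) :
    projMeasure T a μ (Metric.closedBall (codingMap T a x) r) =
      μ {y | dist (codingMap T a y) (codingMap T a x) ≤ r} := by
  rw [projMeasure, Measure.map_apply (measurable_codingMap h0 h1 hTρ a)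
    Metric.isClosed_closedBall.measurableSet]
  rfl

variable [IsProbabilityMeasure μ]

theorem measurable_projMeasure_closedBall (h0 : 0 ≤ ρ) (h1 : ρ < 1)
    (hTρ : ∀ i, opNorm (T i) ≤ ρ) (r : ℝ) :
    Measurable fun p : (Fin m → Euc d) × Shift m =>
      projMeasure T p.1 μ (Metric.closedBall (codingMap T p.1 p.2) r) := by
  simp only [projMeasure_closedBall h0 h1 hTρ]
  have hm := measurable_codingMap_uncurry (d := d) h0 h1 hTρ
  have h2 : Measurable fun q : ((Fin m → Euc d) × Shift m) × Shift m => (q.1.1, q.2) := by fun_prop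
  exact measurable_measure_prodMk_left (ν := μ)
    (s := {q : ((Fin m → Euc d) × Shift m) × Shift m |
      dist (codingMap T q.1.1 q.2) (codingMap T q.1.1 q.1.2) ≤ r})
    (measurableSet_le ((hm.comp h2).dist (hm.comp measurable_fst)) measurable_const)

theorem lintegral_projMeasure_closedBall_le (h0 : 0 ≤ ρ) (h1 : ρ < 1)
    (hTρ : ∀ i, opNorm (T i) ≤ ρ) {ν : Measure (Fin m → Euc d)} [SFinite ν] {C : ℝ≥0∞}
    (hC : C ≠ ∞) {r : ℝ} (x : Shift m)
    (h : ∀ y, ν {a | dist (codingMap T a y) (codingMap T a x) ≤ r} ≤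
      C * ENNReal.ofReal (Zfun T x y r)) :
    ∫⁻ a, projMeasure T a μ (Metric.closedBall (codingMap T a x) r) ∂ν ≤ C * Gfun T μ x r := by
  simp only [projMeasure_closedBall h0 h1 hTρ]
  have hS : MeasurableSet {q : (Fin m → Euc d) × Shift m |
      dist (codingMap T q.1 q.2) (codingMap T q.1 x) ≤ r} :=
    measurableSet_le ((measurable_codingMap_uncurry h0 h1 hTρ).dist
      ((measurable_codingMap_left h0 h1 hTρ x).comp measurable_fst)) measurable_const
  calc ∫⁻ a, μ {y | dist (codingMap T a y) (codingMap T a x) ≤ r} ∂ν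
      = (ν.prod μ) {q : (Fin m → Euc d) × Shift m |
          dist (codingMap T q.1 q.2) (codingMap T q.1 x) ≤ r} := (Measure.prod_apply hS).symm
    _ = ∫⁻ y, ν {a | dist (codingMap T a y) (codingMap T a x) ≤ r} ∂μ :=
        Measure.prod_apply_symm hS
    _ ≤ ∫⁻ y, C * ENNReal.ofReal (Zfun T x y r) ∂μ := lintegral_mono h
    _ = C * Gfun T μ x r := lintegral_const_mul' _ _ hC

theorem ae_eventually_projMeasure_le (h0 : 0 ≤ ρ) (h1 : ρ < 1 / 2) (hT : ∀ i, (T i).det ≠ 0)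
    (hTρ : ∀ i, opNorm (T i) ≤ ρ) (R : ℝ) (x : Shift m) :
    ∀ᵐ a ∂(volume.restrict (transBox m d R)), ∀ᶠ j : ℕ in atTop,
      projMeasure T a μ (Metric.closedBall (codingMap T a x) (dyad j)) ≤
        ENNReal.ofReal (1 * ((j : ℝ) + 1) ^ 2) * Gfun T μ x (dyad j) := by
  have h1' : ρ < 1 := by linarith
  obtain ⟨C, hC, hCle⟩ := exists_transversality h0 h1 hT hTρ R
  have hH : ∀ j, Measurable fun a : Fin m → Euc d =>
      projMeasure T a μ (Metric.closedBall (codingMap T a x) (dyad j)) := by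
    intro j
    have h2 : Measurable fun a : Fin m → Euc d => (a, x) := measurable_prodMk_right
    have h3 := (measurable_projMeasure_closedBall (μ := μ) h0 h1' hTρ (dyad j)).comp h2
    exact h3
  exact ae_eventually_le_of_lintegral_le (H := fun j a =>
      projMeasure T a μ (Metric.closedBall (codingMap T a x) (dyad j)))
    (g := fun j => Gfun T μ x (dyad j))
    hH
    (fun j => Gfun_pos hT (fun i => (hTρ i).trans h1'.le) x (dyad_pos j) (dyad_le_one j))
    (fun j => ((Gfun_le_one hT x (dyad_pos j).le).trans_lt ENNReal.one_lt_top).ne) hC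
    fun j => lintegral_projMeasure_closedBall_le h0 h1' hTρ hC x
      fun y => hCle x y (dyad j) (dyad_pos j)

/-- For each x the estimate holds for almost every a in a box. The event is jointly measurable, so
Fubini swaps the quantifiers, and countably many boxes exhaust parameter space. -/
theorem ae_ae_eventually_projMeasure_le (h0 : 0 ≤ ρ) (h1 : ρ < 1 / 2)
    (hT : ∀ i, (T i).det ≠ 0) (hTρ : ∀ i, opNorm (T i) ≤ ρ) :
    ∀ᵐ a : Fin m → Euc d ∂volume, ∀ᵐ x ∂μ, ∀ᶠ j : ℕ in atTop,
      projMeasure T a μ (Metric.closedBall (codingMap T a x) (dyad j)) ≤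
        ENNReal.ofReal (1 * ((j : ℝ) + 1) ^ 2) * Gfun T μ x (dyad j) := by
  have h1' : ρ < 1 := by linarith
  have hmeas : MeasurableSet {p : (Fin m → Euc d) × Shift m | ∀ᶠ j : ℕ in atTop,
      projMeasure T p.1 μ (Metric.closedBall (codingMap T p.1 p.2) (dyad j)) ≤
        ENNReal.ofReal (1 * ((j : ℝ) + 1) ^ 2) * Gfun T μ p.2 (dyad j)} := by
    have hj : ∀ j : ℕ, MeasurableSet {p : (Fin m → Euc d) × Shift m |
        projMeasure T p.1 μ (Metric.closedBall (codingMap T p.1 p.2) (dyad j)) ≤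
          ENNReal.ofReal (1 * ((j : ℝ) + 1) ^ 2) * Gfun T μ p.2 (dyad j)} := fun j =>
      measurableSet_le (measurable_projMeasure_closedBall h0 h1' hTρ _)
        (((measurable_Gfun (dyad j)).comp measurable_snd).const_mul _)
    have he := MeasurableSet.measurableSet_liminf hj
    convert he using 1
    ext p
    simp only [Set.mem_ofPred_eq, mem_liminf_iff_eventually_mem]
  have hbox : ∀ N : ℕ, ∀ᵐ a ∂(volume.restrict (transBox m d N)), ∀ᵐ x ∂μ, ∀ᶠ j : ℕ in atTop,
      projMeasure T a μ (Metric.closedBall (codingMap T a x) (dyad j)) ≤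
        ENNReal.ofReal (1 * ((j : ℝ) + 1) ^ 2) * Gfun T μ x (dyad j) := fun N =>
    (Measure.ae_ae_comm hmeas).2 (Eventually.of_forall fun x =>
      ae_eventually_projMeasure_le h0 h1 hT hTρ N x)
  have hU : ⋃ N : ℕ, transBox m d N = Set.univ := by
    refine Set.eq_univ_of_forall fun a => ?_
    obtain ⟨N, hN⟩ := exists_nat_ge ‖a‖
    exact Set.mem_iUnion.2 ⟨N, mem_transBox.2 fun i => (norm_le_pi_norm a i).trans hN⟩
  have := (ae_restrict_iUnion_iff (μ := (volume : Measure (Fin m → Euc d)))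
    (fun N : ℕ => transBox m d N) _).2 hbox
  rwa [hU, Measure.restrict_univ] at this

/-- The lower bounds for the local dimensions, for almost all translations. -/
theorem ae_ae_le_locDim (hd : 0 < d) (h0 : 0 ≤ ρ) (h1 : ρ < 1 / 2) (hT : ∀ i, (T i).det ≠ 0)
    (hTρ : ∀ i, opNorm (T i) ≤ ρ) :
    ∀ᵐ a : Fin m → Euc d ∂volume, ∀ᵐ x ∂μ,
      ((min (Sloc T μ x) (d : ℝ≥0∞) : ℝ≥0∞) : EReal) ≤
          lowerLocDim (projMeasure T a μ) (codingMap T a x) ∧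
      Dloc T μ x ≤ upperLocDim (projMeasure T a μ) (codingMap T a x) := by
  have h1' : ρ < 1 := by linarith
  filter_upwards [ae_ae_eventually_projMeasure_le (μ := μ) h0 h1 hT hTρ] with a ha
  have := isProbabilityMeasure_projMeasure (μ := μ) (measurable_codingMap h0 h1' hTρ a)
  filter_upwards [ha] with x hx
  rw [lowerLocDim_eq, upperLocDim_eq, Dloc_eq hT]
  exact ⟨(min_Sloc_le_liminf hd h0 h1' hT hTρ x).trans (liminf_dyadicRatio_le hx),
    limsup_dyadicRatio_le hx⟩

theorem dims_eq_of_measurable {a : Fin m → Euc d} (h : Measurable (codingMap T a)) :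
    lowerHausdorffDim (projMeasure T a μ) =
        essInf (fun x => lowerLocDim (projMeasure T a μ) (codingMap T a x)) μ ∧
      upperHausdorffDim (projMeasure T a μ) =
        essSup (fun x => lowerLocDim (projMeasure T a μ) (codingMap T a x)) μ ∧
      lowerPackingDim (projMeasure T a μ) =
        essInf (fun x => upperLocDim (projMeasure T a μ) (codingMap T a x)) μ ∧
      upperPackingDim (projMeasure T a μ) =
        essSup (fun x => upperLocDim (projMeasure T a μ) (codingMap T a x)) μ := by
  have := isProbabilityMeasure_projMeasure (μ := μ) h
  exact ⟨essInf_map_eq h (measurable_lowerLocDim _), essSup_map_eq h (measurable_lowerLocDim _),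
    essInf_map_eq h (measurable_upperLocDim _), essSup_map_eq h (measurable_upperLocDim _)⟩

end Lower

end

/-! ### The theorem -/

theorem theorem1p1 (m d : ℕ) (hd : 0 < d) (T : Fin m → Matrix (Fin d) (Fin d) ℝ)
    (hT : ∀ i, (T i).det ≠ 0) (hT1 : ∀ i, opNorm (T i) < 1)
    (μ : Measure (Shift m)) [IsProbabilityMeasure μ] :
    (∀ a : Fin m → Euc d,
      (∀ᵐ x ∂μ,
        lowerLocDim (projMeasure T a μ) (codingMap T a x) ≤
            ((min (Sloc T μ x) (d : ℝ≥0∞) : ℝ≥0∞) : EReal) ∧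
        upperLocDim (projMeasure T a μ) (codingMap T a x) ≤ Dloc T μ x) ∧
      lowerHausdorffDim (projMeasure T a μ) ≤ ((min (Slower T μ) (d : ℝ≥0∞) : ℝ≥0∞) : EReal) ∧
      upperHausdorffDim (projMeasure T a μ) ≤ ((min (Supper T μ) (d : ℝ≥0∞) : ℝ≥0∞) : EReal) ∧
      lowerPackingDim (projMeasure T a μ) ≤ Dlower T μ ∧
      upperPackingDim (projMeasure T a μ) ≤ Dupper T μ) ∧
    ((∀ i, opNorm (T i) < 1 / 2) →
      ∀ᵐ a : Fin m → Euc d ∂volume,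
        (∀ᵐ x ∂μ,
          lowerLocDim (projMeasure T a μ) (codingMap T a x) =
              ((min (Sloc T μ x) (d : ℝ≥0∞) : ℝ≥0∞) : EReal) ∧
          upperLocDim (projMeasure T a μ) (codingMap T a x) = Dloc T μ x) ∧
        lowerHausdorffDim (projMeasure T a μ) = ((min (Slower T μ) (d : ℝ≥0∞) : ℝ≥0∞) : EReal) ∧
        upperHausdorffDim (projMeasure T a μ) = ((min (Supper T μ) (d : ℝ≥0∞) : ℝ≥0∞) : EReal) ∧
        lowerPackingDim (projMeasure T a μ) = Dlower T μ ∧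
        upperPackingDim (projMeasure T a μ) = Dupper T μ) := by
  have hnn : ∀ i, 0 ≤ opNorm (T i) := fun i => norm_nonneg _
  obtain ⟨ρ, h0, h1, hTρ⟩ := exists_uniform_bound one_pos hnn hT1
  refine ⟨fun a => ?_, fun hhalf => ?_⟩
  · have hae := ae_locDim_le (μ := μ) hd h0 h1 hT hTρ a
    obtain ⟨e1, e2, e3, e4⟩ := dims_eq_of_measurable (μ := μ) (measurable_codingMap h0 h1 hTρ a)
    rw [e1, e2, e3, e4, Slower, Supper, ← essInf_coe_min, ← essSup_coe_min]
    exact ⟨hae, essInf_mono_ae (hae.mono fun x hx => hx.1),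
      essSup_mono_ae (hae.mono fun x hx => hx.1), essInf_mono_ae (hae.mono fun x hx => hx.2),
      essSup_mono_ae (hae.mono fun x hx => hx.2)⟩
  · obtain ⟨ρ', h0', h1', hTρ'⟩ := exists_uniform_bound one_half_pos hnn hhalf
    filter_upwards [ae_ae_le_locDim (μ := μ) hd h0' h1' hT hTρ'] with a ha
    have hae : ∀ᵐ x ∂μ,
        lowerLocDim (projMeasure T a μ) (codingMap T a x) =
          ((min (Sloc T μ x) (d : ℝ≥0∞) : ℝ≥0∞) : EReal) ∧
        upperLocDim (projMeasure T a μ) (codingMap T a x) = Dloc T μ x := by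
      -- The upper bound holds for every translation, so it adds no exceptional a, only a μ-null set
      -- of x.
      filter_upwards [ha, ae_locDim_le (μ := μ) hd h0 h1 hT hTρ a] with x hx hx'
      exact ⟨le_antisymm hx'.1 hx.1, le_antisymm hx'.2 hx.2⟩
    obtain ⟨e1, e2, e3, e4⟩ := dims_eq_of_measurable (μ := μ) (measurable_codingMap h0 h1 hTρ a)
    rw [e1, e2, e3, e4, Slower, Supper, ← essInf_coe_min, ← essSup_coe_min]
    exact ⟨hae, essInf_congr_ae (hae.mono fun x hx => hx.1),
      essSup_congr_ae (hae.mono fun x hx => hx.1), essInf_congr_ae (hae.mono fun x hx => hx.2),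
      essSup_congr_ae (hae.mono fun x hx => hx.2)⟩
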